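/- There is an absolute constant $C>0$ such that the following holds. Let $A\in\mathbb{R}^{m\times n}$ with $m\ge n$ have full column rank, let $\sigma_{\min}(A)$ and $\sigma_{\max}(A)$ be its smallest and largest singular values, and put $\kappa^2(A)=\sigma_{\max}^2(A)/\sigma_{\min}^2(A)$. Let $b\in\mathbb{R}^m$, let $x_*\in\mathbb{R}^n$ be a minimizer of $\|Ax-b\|_2^2$ over $x\in\mathbb{R}^n$, and let $e:=Ax_*-b$. Let $s<n$, let $c>3$, and let $N$ be an integer with $$64\,c\,m^2\log m\;\le\; N\;\le\;\exp\!\big((\sqrt n-\sqrt s)^2/16\big).$$ Let $\mathcal S=\{S^{(1)},\dots,S^{(N)}\}$ be a collection of independent random $m\times s$ matrices with i.i.d. standard normal entries. Then, with probability at least $1-1.1\,m^{3-c}-e^{-(\sqrt n-\sqrt s)^2/16}$ over the draw of $\mathcal S$, the following is true for every initial estimate $x_0\in\mathbb{R}^n$ and every $k\ge 0$: if the iterates are produced by $$x_{k+1}=\big(I-(S^TA)^\dagger S^TA\big)x_k+(S^TA)^\dagger S^Tb,$$ where $\dagger$ is the Moore–Penrose inverse and, at each step, $S$ is drawn from $\mathcal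 S$ uniformly at random, with replacement and independently of the earlier steps, then $$\mathbb{E}\|x_k-x_*\|_2^2\;\le\;\Big(1-\frac{s}{36\,m\,\kappa^2(A)}\Big)^k\|x_0-x_*\|_2^2+\frac{C\,m\,\kappa^2(A)}{\sigma_{\min}^2(A)}\cdot\frac{\|e\|_2^2}{(\sqrt n-\sqrt s)^2},$$ where $\mathbb{E}$ is the expectation over the draws of $S$ from the fixed collection $\mathcal S$. -/

import Mathlib

open MeasureTheory ProbabilityTheory
open scoped Matrix

/-- The four Penrose equations: `X` is a Moore–Penrose inverse of the real matrix `M`. -/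
structure IsMoorePenrose {p q : ℕ} (M : Matrix (Fin p) (Fin q) ℝ)
    (X : Matrix (Fin q) (Fin p) ℝ) : Prop where
  mul_mul_self : M * X * M = M
  self_mul_mul : X * M * X = X
  symm_left : (M * X)ᵀ = M * X
  symm_right : (X * M)ᵀ = X * M

/-- Every real matrix has a Moore–Penrose inverse. -/
theorem exists_isMoorePenrose {p q : ℕ} (M : Matrix (Fin p) (Fin q) ℝ) :
    ∃ X, IsMoorePenrose M X := by
  have hH : (Mᵀ * M).IsHermitian := by
    rw [← Matrix.conjTranspose_eq_transpose_of_trivial]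
    exact Matrix.isHermitian_conjTranspose_mul_self M
  obtain ⟨U, d, hU, hM⟩ : ∃ (U : Matrix (Fin q) (Fin q) ℝ) (d : Fin q → ℝ),
      Uᵀ * U = 1 ∧ Mᵀ * M = U * Matrix.diagonal d * Uᵀ := by
    refine ⟨hH.eigenvectorUnitary, hH.eigenvalues, ?_, ?_⟩
    · have h := Unitary.coe_star_mul_self hH.eigenvectorUnitary
      rwa [Matrix.star_eq_conjTranspose, Matrix.conjTranspose_eq_transpose_of_trivial] at h
    · have h := hH.spectral_theorem
      rw [Unitary.conjStarAlgAut_apply, Matrix.star_eq_conjTranspose,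
        Matrix.conjTranspose_eq_transpose_of_trivial] at h
      exact h
  set G := U * Matrix.diagonal (fun i => (d i)⁻¹) * Uᵀ with hG
  have hGt : Gᵀ = G := by
    simp [hG, Matrix.transpose_mul, Matrix.mul_assoc]
  have key : ∀ a b : Fin q → ℝ, (U * Matrix.diagonal a * Uᵀ) * (U * Matrix.diagonal b * Uᵀ)
      = U * Matrix.diagonal (fun i => a i * b i) * Uᵀ := by
    intro a b
    calc _ = U * Matrix.diagonal a * (Uᵀ * U) * Matrix.diagonal b * Uᵀ := by
          simp only [Matrix.mul_assoc]
      _ = _ := by rw [hU, Matrix.mul_one, Matrix.mul_assoc U, Matrix.diagonal_mul_diagonal]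
  have hGM : G * (Mᵀ * M) = U * Matrix.diagonal (fun i => (d i)⁻¹ * d i) * Uᵀ := by
    rw [hM, hG, key]
  have hPt : (G * (Mᵀ * M))ᵀ = G * (Mᵀ * M) := by
    rw [hGM]; simp [Matrix.transpose_mul, Matrix.mul_assoc]
  have hPM : Mᵀ * M * (G * (Mᵀ * M)) = Mᵀ * M := by
    rw [hGM, hM, key]
    congr 3
    funext i
    by_cases h : d i = 0 <;> simp [h]
  have hPG : G * (Mᵀ * M) * G = G := by
    rw [hGM, hG, key]
    congr 3
    funext i
    by_cases h : d i = 0 <;> simp [h]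
  have h0 : M * (G * (Mᵀ * M)) - M = 0 := by
    rw [← Matrix.conjTranspose_mul_self_eq_zero, Matrix.conjTranspose_eq_transpose_of_trivial,
      Matrix.transpose_sub, Matrix.transpose_mul, hPt, Matrix.sub_mul, Matrix.mul_sub,
      Matrix.mul_sub]
    have e1 : Mᵀ * (M * (G * (Mᵀ * M))) = Mᵀ * M := by rw [← Matrix.mul_assoc, hPM]
    rw [Matrix.mul_assoc (G * (Mᵀ * M)), Matrix.mul_assoc (G * (Mᵀ * M)), e1]
    simp
  refine ⟨G * Mᵀ, ?_, ?_, ?_, ?_⟩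
  · rw [Matrix.mul_assoc, Matrix.mul_assoc G]
    exact sub_eq_zero.mp h0
  · calc _ = G * (Mᵀ * M) * G * Mᵀ := by simp only [Matrix.mul_assoc]
      _ = _ := by rw [hPG]
  · simp only [Matrix.transpose_mul, Matrix.transpose_transpose, hGt, Matrix.mul_assoc]
  · rw [Matrix.mul_assoc, hPt]

/-- The Moore–Penrose inverse is unique. -/
theorem IsMoorePenrose.unique {p q : ℕ} {M : Matrix (Fin p) (Fin q) ℝ}
    {X Y : Matrix (Fin q) (Fin p) ℝ} (hX : IsMoorePenrose M X) (hY : IsMoorePenrose M Y) :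
    X = Y := by
  have h1 : M * X = M * Y := by
    calc M * X = (M * Y) * (M * X) := by rw [← Matrix.mul_assoc, hY.mul_mul_self]
      _ = (M * Y)ᵀ * (M * X)ᵀ := by rw [hX.symm_left, hY.symm_left]
      _ = (M * X * M * Y)ᵀ := by rw [← Matrix.transpose_mul]; simp only [Matrix.mul_assoc]
      _ = M * Y := by rw [hX.mul_mul_self, hY.symm_left]
  have h2 : X * M = Y * M := by
    calc X * M = (X * M) * (Y * M) := by
          rw [Matrix.mul_assoc, ← Matrix.mul_assoc M, hY.mul_mul_self]
      _ = (X * M)ᵀ * (Y * M)ᵀ := by rw [hX.symm_right, hY.symm_right]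
      _ = (Y * (M * X * M))ᵀ := by rw [← Matrix.transpose_mul]; simp only [Matrix.mul_assoc]
      _ = Y * M := by rw [hX.mul_mul_self, hY.symm_right]
  rw [← hX.self_mul_mul, Matrix.mul_assoc, h1, ← Matrix.mul_assoc, h2, hY.self_mul_mul]

/-- The Moore–Penrose inverse `M†`. -/
noncomputable def pinv {p q : ℕ} (M : Matrix (Fin p) (Fin q) ℝ) : Matrix (Fin q) (Fin p) ℝ :=
  Classical.choose (exists_isMoorePenrose M)

theorem pinv_spec {p q : ℕ} (M : Matrix (Fin p) (Fin q) ℝ) : IsMoorePenrose M (pinv M) :=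
  Classical.choose_spec (exists_isMoorePenrose M)

/-- The smallest singular value of an `m × n` matrix (`n ≥ 1`): the last of the `n` square roots
of the eigenvalues of `AᵀA`, listed in decreasing order. -/
noncomputable def sigmaMin {m n : ℕ} (A : Matrix (Fin m) (Fin n) ℝ) : ℝ :=
  (Matrix.toEuclideanLin A).singularValues (n - 1)

/-- The largest singular value of `A`. -/
noncomputable def sigmaMax {m n : ℕ} (A : Matrix (Fin m) (Fin n) ℝ) : ℝ :=
  (Matrix.toEuclideanLin A).singularValues 0

/-- `κ²(A) = σ_max²(A) / σ_min²(A)`. -/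
noncomputable def kappaSq {m n : ℕ} (A : Matrix (Fin m) (Fin n) ℝ) : ℝ :=
  sigmaMax A ^ 2 / sigmaMin A ^ 2

/-- `x` minimizes `‖Ay - b‖₂²` over all `y ∈ ℝⁿ`. -/
def IsLeastSquaresSol {m n : ℕ} (A : Matrix (Fin m) (Fin n) ℝ)
    (b : EuclideanSpace ℝ (Fin m)) (x : EuclideanSpace ℝ (Fin n)) : Prop :=
  ∀ y : EuclideanSpace ℝ (Fin n),
    ‖Matrix.toEuclideanLin A x - b‖ ^ 2 ≤ ‖Matrix.toEuclideanLin A y - b‖ ^ 2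

/-- One sketch-and-project step with sketch `S`:
`x ↦ (I - (SᵀA)† SᵀA) x + (SᵀA)† Sᵀ b`. -/
noncomputable def sketchStep {m n s : ℕ} (A : Matrix (Fin m) (Fin n) ℝ)
    (b : EuclideanSpace ℝ (Fin m)) (S : Matrix (Fin m) (Fin s) ℝ)
    (x : EuclideanSpace ℝ (Fin n)) : EuclideanSpace ℝ (Fin n) :=
  Matrix.toEuclideanLin (1 - pinv (Sᵀ * A) * (Sᵀ * A)) x
    + Matrix.toEuclideanLin (pinv (Sᵀ * A) * Sᵀ) b

/-- The iterates `x_k` produced from `x₀` when the step from `x_k` to `x_{k+1}` uses the member of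
index `idx k` of the collection `S 0, …, S (N - 1)`. -/
noncomputable def finiteBGK {m n s N : ℕ} (A : Matrix (Fin m) (Fin n) ℝ)
    (b : EuclideanSpace ℝ (Fin m)) (S : Fin N → Matrix (Fin m) (Fin s) ℝ)
    (idx : ℕ → Fin N) (x₀ : EuclideanSpace ℝ (Fin n)) : ℕ → EuclideanSpace ℝ (Fin n)
  | 0 => x₀
  | k + 1 => sketchStep A b (S (idx k)) (finiteBGK A b S idx x₀ k)

/-- A random collection of `N` matrices of size `m × s`, all of whose `N * m * s` entries are
independent standard normal random variables on `(Ω, P)`. -/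
structure IsGaussianCollection {Ω : Type*} [MeasurableSpace Ω] (P : Measure Ω) {m s N : ℕ}
    (S : Ω → Fin N → Matrix (Fin m) (Fin s) ℝ) : Prop where
  law : ∀ (l : Fin N) (i : Fin m) (j : Fin s),
    HasLaw (fun ω => S ω l i j) (gaussianReal 0 1) P
  indep : iIndepFun (fun (t : Fin N × Fin m × Fin s) ω => S ω t.1 t.2.1 t.2.2) P

/-- Uniform sampling with replacement from `N` items: an independent sequence of indices on
`(Ω, Q)`, each uniformly distributed. -/
structure IsUniformSampling {Ω : Type*} [MeasurableSpace Ω] (Q : Measure Ω) {N : ℕ}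
    (τ : Ω → ℕ → Fin N) : Prop where
  law : ∀ k : ℕ, HasLaw (fun ω => τ ω k) (uniformOn Set.univ) Q
  indep : iIndepFun (fun (k : ℕ) ω => τ ω k) Q

/-! Write `M = SᵀA`, let `P = M†M` be the orthogonal projection onto the row space of `M`, and `e =
A x_* - b`. Pythagoras makes one step exact (`norm_sq_sketchStep_sub`): the squared error loses
`‖P(x - x_*)‖²` and gains `‖M† Sᵀe‖²`. Averaged over a fixed collection, the loss has to be at least
`s/(36 m κ²)` times the squared error, for all errors at once, and the gain has to be bounded. Since
the next index is independent of the current iterate, these two bounds give an affine recursion for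
the mean squared error (`IsUniformSampling.integral_finiteBGK_le`).

The loss: let `Q` be the projection onto the column space of `S`. Then `‖Q A v‖ ≤ σ_max ‖P v‖`
(`colProj_mulVec_le`), so it suffices to bound the average of `‖Q u‖²` below, uniformly in `u`.
Rotation invariance makes its mean the same for all unit `u`, and the trace of `Q` makes that mean
at least `s/(2m)`. A Chernoff bound treats a single `u`, a union bound over a grid of `(16m+1)^m`
points treats the grid, and rounding gives every `u` (`le_sum_projForm_of_notMem_gridFailure`).

The gain: as `Aᵀe = 0`, the Gaussian vector `Sᵀe` is independent of `M`. Given `M`, the gain is a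
Gaussian quadratic form of trace `‖e‖² tr (M Mᵀ)⁻¹`, whose average over the collection has an
exponential tail (`measure_pi_residualFailure_le`). For the trace no bound on the spectrum of `M` is
needed: the diagonal entries of `(M Mᵀ)⁻¹` are inverse squared distances of a row to the span of the
others. Resampling one column of `S` bounds such a distance below by the projection of a Gaussian
vector onto a space of dimension at least `n + 1 - s` (`stdGaussian_nearDependent_le`). This costs a
factor `s` in the trace, which cancels the `s` of the contraction rate. -/

/-! ### Singular values as extremal stretching factors. -/

section SingularValues

open LinearMap in
theorem LinearMap.sum_sq_singularValues_mul_inner {E F : Type*} [NormedAddCommGroup E]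
    [InnerProductSpace ℝ E] [FiniteDimensional ℝ E] [NormedAddCommGroup F] [InnerProductSpace ℝ F]
    [FiniteDimensional ℝ F] (T : E →ₗ[ℝ] F) {n : ℕ} (hn : Module.finrank ℝ E = n) (v : E) :
    ‖T v‖ ^ 2 = ∑ i : Fin n, T.singularValues i ^ 2 *
      (T.isSymmetric_adjoint_comp_self.eigenvectorBasis hn).repr v i ^ 2 := by
  have h1 : ‖T v‖ ^ 2 = inner ℝ ((adjoint T ∘ₗ T) v) v := by
    rw [LinearMap.comp_apply, LinearMap.adjoint_inner_left, real_inner_self_eq_norm_sq]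
  set b := T.isSymmetric_adjoint_comp_self.eigenvectorBasis hn
  rw [h1, ← b.repr.inner_map_map, PiLp.inner_apply]
  refine Finset.sum_congr rfl fun i _ => ?_
  rw [T.isSymmetric_adjoint_comp_self.eigenvectorBasis_apply_self_apply hn v i,
    T.sq_singularValues_fin hn]
  simp only [RCLike.inner_apply, conj_trivial, RCLike.ofReal_real_eq_id, id_eq]
  change b.repr v i * (_ * b.repr v i) = _ * b.repr v i ^ 2
  ring

variable {m n : ℕ} {A : Matrix (Fin m) (Fin n) ℝ}

theorem sigmaMin_nonneg : 0 ≤ sigmaMin A := LinearMap.singularValues_nonneg _ _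

theorem sigmaMin_le_sigmaMax : sigmaMin A ≤ sigmaMax A :=
  LinearMap.singularValues_antitone _ (Nat.zero_le _)

theorem sigmaMin_pos (hn : 0 < n) (hA : A.rank = n) : 0 < sigmaMin A := by
  unfold sigmaMin
  rw [LinearMap.singularValues_pos_iff_lt_finrank_range]
  have : Module.finrank ℝ (LinearMap.range (Matrix.toEuclideanLin A)) = n := by
    have h := Matrix.rank_eq_finrank_range_toLin A (EuclideanSpace.basisFun (Fin m) ℝ).toBasis
      (EuclideanSpace.basisFun (Fin n) ℝ).toBasis
    rw [← Matrix.toEuclideanLin_eq_toLin_orthonormal, hA] at h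
    exact h.symm
  omega

theorem sigmaMin_sq_mul_le (v : EuclideanSpace ℝ (Fin n)) :
    sigmaMin A ^ 2 * ‖v‖ ^ 2 ≤ ‖Matrix.toEuclideanLin A v‖ ^ 2 := by
  have hn : Module.finrank ℝ (EuclideanSpace ℝ (Fin n)) = n := by simp
  rw [LinearMap.sum_sq_singularValues_mul_inner _ hn]
  set b := (Matrix.toEuclideanLin A).isSymmetric_adjoint_comp_self.eigenvectorBasis hn
  rw [← b.repr.norm_map v, EuclideanSpace.real_norm_sq_eq, Finset.mul_sum]
  refine Finset.sum_le_sum fun i _ => ?_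
  gcongr
  · exact sigmaMin_nonneg
  · exact LinearMap.singularValues_antitone _ (by omega)

theorem norm_sq_le_sigmaMax_sq_mul (v : EuclideanSpace ℝ (Fin n)) :
    ‖Matrix.toEuclideanLin A v‖ ^ 2 ≤ sigmaMax A ^ 2 * ‖v‖ ^ 2 := by
  have hn : Module.finrank ℝ (EuclideanSpace ℝ (Fin n)) = n := by simp
  rw [LinearMap.sum_sq_singularValues_mul_inner _ hn]
  set b := (Matrix.toEuclideanLin A).isSymmetric_adjoint_comp_self.eigenvectorBasis hn
  rw [← b.repr.norm_map v, EuclideanSpace.real_norm_sq_eq, Finset.mul_sum]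
  refine Finset.sum_le_sum fun i _ => ?_
  gcongr
  · exact LinearMap.singularValues_nonneg _ _
  · exact LinearMap.singularValues_antitone _ (by omega)

end SingularValues

/-! ### Dot-product estimates and the normal equations. -/

section Vectors

theorem EuclideanSpace.norm_sq_eq_dotProduct {ι : Type*} [Fintype ι] (x : EuclideanSpace ℝ ι) :
    ‖x‖ ^ 2 = x.ofLp ⬝ᵥ x.ofLp := by
  rw [EuclideanSpace.real_norm_sq_eq, dotProduct]
  simp only [sq]

theorem norm_sq_toEuclideanLin {m n : ℕ} (A : Matrix (Fin m) (Fin n) ℝ)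
    (v : EuclideanSpace ℝ (Fin n)) :
    ‖Matrix.toEuclideanLin A v‖ ^ 2 = (A *ᵥ v.ofLp) ⬝ᵥ (A *ᵥ v.ofLp) := by
  rw [EuclideanSpace.norm_sq_eq_dotProduct]; rfl

theorem Matrix.mulVec_dotProduct {p q : Type*} [Fintype p] [Fintype q] (M : Matrix p q ℝ)
    (x : q → ℝ) (y : p → ℝ) : (M *ᵥ x) ⬝ᵥ y = x ⬝ᵥ (Mᵀ *ᵥ y) := by
  rw [dotProduct_comm, Matrix.dotProduct_mulVec, Matrix.mulVec_transpose, dotProduct_comm]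

theorem dotProduct_self_nonneg' {ι : Type*} [Fintype ι] (x : ι → ℝ) : 0 ≤ x ⬝ᵥ x :=
  Finset.sum_nonneg fun _ _ => mul_self_nonneg _

theorem dotProduct_sq_le {ι : Type*} [Fintype ι] (x y : ι → ℝ) :
    (x ⬝ᵥ y) ^ 2 ≤ (x ⬝ᵥ x) * (y ⬝ᵥ y) := by
  have := Finset.sum_mul_sq_le_sq_mul_sq Finset.univ x y
  simpa [dotProduct, sq] using this

variable {m n : ℕ} {A : Matrix (Fin m) (Fin n) ℝ}

theorem sigmaMin_sq_mul_dotProduct_le (v : Fin n → ℝ) :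
    sigmaMin A ^ 2 * (v ⬝ᵥ v) ≤ (A *ᵥ v) ⬝ᵥ (A *ᵥ v) := by
  have h := sigmaMin_sq_mul_le (A := A) (WithLp.toLp 2 v)
  rwa [norm_sq_toEuclideanLin, EuclideanSpace.norm_sq_eq_dotProduct] at h

theorem dotProduct_le_sigmaMax_sq_mul (v : Fin n → ℝ) :
    (A *ᵥ v) ⬝ᵥ (A *ᵥ v) ≤ sigmaMax A ^ 2 * (v ⬝ᵥ v) := by
  have h := norm_sq_le_sigmaMax_sq_mul (A := A) (WithLp.toLp 2 v)
  rwa [norm_sq_toEuclideanLin, EuclideanSpace.norm_sq_eq_dotProduct] at h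

/-- With `w = Aᵀy`, `‖w‖² = ⟨Aw, y⟩`, so Cauchy–Schwarz gives `‖w‖⁴ ≤ σ_max² ‖w‖² ‖y‖²` and one
factor `‖w‖²` cancels. -/
theorem transpose_mulVec_dotProduct_le (y : Fin m → ℝ) :
    (Aᵀ *ᵥ y) ⬝ᵥ (Aᵀ *ᵥ y) ≤ sigmaMax A ^ 2 * (y ⬝ᵥ y) := by
  set w := Aᵀ *ᵥ y
  have h1 : w ⬝ᵥ w = (A *ᵥ w) ⬝ᵥ y := (Matrix.mulVec_dotProduct A w y).symm
  have h2 := dotProduct_sq_le (A *ᵥ w) y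
  have h3 := dotProduct_le_sigmaMax_sq_mul (A := A) w
  have h4 := dotProduct_self_nonneg' y
  have h5 := dotProduct_self_nonneg' w
  rcases h5.eq_or_lt with h | h
  · rw [← h]; positivity
  · rw [← h1] at h2
    have : w ⬝ᵥ w * (w ⬝ᵥ w) ≤ w ⬝ᵥ w * (sigmaMax A ^ 2 * (y ⬝ᵥ y)) := by
      nlinarith [mul_le_mul_of_nonneg_right h3 h4]
    exact le_of_mul_le_mul_left this h

/-- The residual of a least-squares solution is orthogonal to the range of `A`. -/
theorem IsLeastSquaresSol.transpose_mulVec_eq_zero {b : EuclideanSpace ℝ (Fin m)}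
    {x : EuclideanSpace ℝ (Fin n)} (h : IsLeastSquaresSol A b x) :
    Aᵀ *ᵥ (A *ᵥ x.ofLp - b.ofLp) = 0 := by
  set e := A *ᵥ x.ofLp - b.ofLp with he
  set w := Aᵀ *ᵥ e with hw
  -- Minimality along the gradient direction `w`; the linear term forces `w = 0`.
  have key : ∀ t : ℝ, 0 ≤ 2 * t * (w ⬝ᵥ w) + t ^ 2 * ((A *ᵥ w) ⬝ᵥ (A *ᵥ w)) := by
    intro t
    have h1 := h (x + t • WithLp.toLp 2 w)
    rw [EuclideanSpace.norm_sq_eq_dotProduct, EuclideanSpace.norm_sq_eq_dotProduct] at h1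
    have h2 : (Matrix.toEuclideanLin A x - b).ofLp = e := rfl
    have h3 : (Matrix.toEuclideanLin A (x + t • WithLp.toLp 2 w) - b).ofLp
        = e + t • (A *ᵥ w) := by
      change A *ᵥ (x.ofLp + t • w) - b.ofLp = _
      rw [Matrix.mulVec_add, Matrix.mulVec_smul, he]; abel
    rw [h2, h3] at h1
    have h4 : (A *ᵥ w) ⬝ᵥ e = w ⬝ᵥ w := by rw [Matrix.mulVec_dotProduct]
    have h5 : e ⬝ᵥ (A *ᵥ w) = w ⬝ᵥ w := by rw [dotProduct_comm, h4]
    simp only [add_dotProduct, dotProduct_add, smul_dotProduct, dotProduct_smul, smul_eq_mul,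
      h4, h5] at h1
    linarith
  have hnn := dotProduct_self_nonneg' w
  have hzz := dotProduct_self_nonneg' (A *ᵥ w)
  have : w ⬝ᵥ w = 0 := by
    by_contra hne
    have hpos : 0 < w ⬝ᵥ w := lt_of_le_of_ne hnn (Ne.symm hne)
    set a := w ⬝ᵥ w
    set z := (A *ᵥ w) ⬝ᵥ (A *ᵥ w)
    -- Nearly the minimizing `t = -a/z`; the `+ 1` keeps the denominator positive when `z = 0`.
    have h1 := key (-(a / (z + 1)))
    have hz1 : (0:ℝ) < z + 1 := by linarith
    have h2 : 2 * -(a / (z + 1)) * a + (-(a / (z + 1))) ^ 2 * z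
        = -(a ^ 2 * (z + 2) / (z + 1) ^ 2) := by field_simp; ring
    rw [h2] at h1
    have : 0 < a ^ 2 * (z + 2) / (z + 1) ^ 2 := by positivity
    linarith
  exact dotProduct_self_eq_zero.mp this

end Vectors

/-! ### One step of the method and the projection onto the column space of the sketch. -/

section SketchStep

variable {m n s : ℕ} {A : Matrix (Fin m) (Fin n) ℝ}

/-- The sketched residual correction and the projected error are orthogonal. -/
theorem norm_sq_sketchStep_sub (b : EuclideanSpace ℝ (Fin m)) (S : Matrix (Fin m) (Fin s) ℝ)
    (x xs : EuclideanSpace ℝ (Fin n)) :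
    ‖sketchStep A b S x - xs‖ ^ 2 = ‖x - xs‖ ^ 2
      - ((pinv (Sᵀ * A) * (Sᵀ * A)) *ᵥ (x - xs).ofLp) ⬝ᵥ
          ((pinv (Sᵀ * A) * (Sᵀ * A)) *ᵥ (x - xs).ofLp)
      + (pinv (Sᵀ * A) *ᵥ (Sᵀ *ᵥ (A *ᵥ xs.ofLp - b.ofLp))) ⬝ᵥ
          (pinv (Sᵀ * A) *ᵥ (Sᵀ *ᵥ (A *ᵥ xs.ofLp - b.ofLp))) := by
  obtain ⟨h1, h2, h3, h4⟩ := pinv_spec (Sᵀ * A)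
  set M := Sᵀ * A
  set X := pinv M
  set v := (x - xs).ofLp with hv
  set g := Sᵀ *ᵥ (A *ᵥ xs.ofLp - b.ofLp) with hg
  -- Substitute `Sᵀb = M xs - g`. Then `v - XMv` is orthogonal to the range of the projection `XM`,
  -- while `Xg` lies in it.
  have hstep : (sketchStep A b S x - xs).ofLp = v - (X * M) *ᵥ v - X *ᵥ g := by
    change (1 - X * M) *ᵥ x.ofLp + (X * Sᵀ) *ᵥ b.ofLp - xs.ofLp = _
    have : v = x.ofLp - xs.ofLp := rfl
    have hx : Sᵀ *ᵥ (A *ᵥ xs.ofLp) = M *ᵥ xs.ofLp := Matrix.mulVec_mulVec _ _ _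
    rw [this, hg, Matrix.sub_mulVec, Matrix.one_mulVec]
    simp only [Matrix.mulVec_sub, hx, ← Matrix.mulVec_mulVec]
    abel
  rw [EuclideanSpace.norm_sq_eq_dotProduct, EuclideanSpace.norm_sq_eq_dotProduct, hstep, ← hv]
  have e1 : (X * M) *ᵥ ((X * M) *ᵥ v) = (X * M) *ᵥ v := by
    rw [Matrix.mulVec_mulVec, ← Matrix.mul_assoc, h2]
  have e2 : (X * M) *ᵥ (X *ᵥ g) = X *ᵥ g := by
    rw [Matrix.mulVec_mulVec, h2]
  have sym : ∀ a c : Fin n → ℝ, ((X * M) *ᵥ a) ⬝ᵥ c = a ⬝ᵥ ((X * M) *ᵥ c) := by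
    intro a c; rw [Matrix.mulVec_dotProduct, h4]
  have f1 : ((X * M) *ᵥ v) ⬝ᵥ ((X * M) *ᵥ v) = v ⬝ᵥ ((X * M) *ᵥ v) := by rw [sym, e1]
  have f2 : ((X * M) *ᵥ v) ⬝ᵥ (X *ᵥ g) = v ⬝ᵥ (X *ᵥ g) := by rw [sym, e2]
  simp only [sub_dotProduct, dotProduct_sub]
  rw [dotProduct_comm ((X * M) *ᵥ v) v, dotProduct_comm (X *ᵥ g) v,
    dotProduct_comm (X *ᵥ g) ((X * M) *ᵥ v), f1, f2]
  ring

/-- The orthogonal projection onto the column space of `S`, if `S` has full column rank; zero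
otherwise. -/
noncomputable def colProj {m s : ℕ} (S : Matrix (Fin m) (Fin s) ℝ) : Matrix (Fin m) (Fin m) ℝ :=
  S * (Sᵀ * S)⁻¹ * Sᵀ

theorem colProj_transpose (S : Matrix (Fin m) (Fin s) ℝ) : (colProj S)ᵀ = colProj S := by
  simp only [colProj, Matrix.transpose_mul, Matrix.transpose_transpose,
    Matrix.transpose_nonsing_inv, Matrix.mul_assoc]

theorem colProj_mul_self (S : Matrix (Fin m) (Fin s) ℝ) : colProj S * colProj S = colProj S := by
  by_cases h : IsUnit (Sᵀ * S).det
  · unfold colProj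
    calc _ = S * (Sᵀ * S)⁻¹ * ((Sᵀ * S) * (Sᵀ * S)⁻¹) * Sᵀ := by simp only [Matrix.mul_assoc]
      _ = _ := by rw [Matrix.mul_nonsing_inv _ h, Matrix.mul_one]
  · simp [colProj, Matrix.nonsing_inv_apply_not_isUnit _ h]

theorem colProj_mulVec_dotProduct (S : Matrix (Fin m) (Fin s) ℝ) (u : Fin m → ℝ) :
    (colProj S *ᵥ u) ⬝ᵥ (colProj S *ᵥ u) = u ⬝ᵥ (colProj S *ᵥ u) := by
  rw [Matrix.mulVec_dotProduct, colProj_transpose, Matrix.mulVec_mulVec, colProj_mul_self]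

theorem colProj_mulVec_dotProduct_le (S : Matrix (Fin m) (Fin s) ℝ) (u : Fin m → ℝ) :
    (colProj S *ᵥ u) ⬝ᵥ (colProj S *ᵥ u) ≤ u ⬝ᵥ u := by
  have h := dotProduct_self_nonneg' (u - colProj S *ᵥ u)
  simp only [sub_dotProduct, dotProduct_sub] at h
  rw [dotProduct_comm (colProj S *ᵥ u) u, colProj_mulVec_dotProduct] at h
  rw [colProj_mulVec_dotProduct]
  linarith

theorem colProj_trace (S : Matrix (Fin m) (Fin s) ℝ) (h : IsUnit (Sᵀ * S).det) :
    (colProj S).trace = s := by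
  rw [colProj, Matrix.mul_assoc, Matrix.trace_mul_comm, Matrix.mul_assoc,
    Matrix.nonsing_inv_mul _ h, Matrix.trace_one, Fintype.card_fin]

/-- For `z = Q A v`, the vector `w = Aᵀz` lies in the row space of `SᵀA`, hence is fixed by `P`. So
`‖z‖² = ⟨v, w⟩ = ⟨P v, w⟩ ≤ ‖P v‖ · σ_max ‖z‖`. This trades the projection depending on `A` for one
depending on `S` alone. -/
theorem colProj_mulVec_le (S : Matrix (Fin m) (Fin s) ℝ) (v : Fin n → ℝ) :
    (colProj S *ᵥ (A *ᵥ v)) ⬝ᵥ (colProj S *ᵥ (A *ᵥ v)) ≤ sigmaMax A ^ 2 *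
      (((pinv (Sᵀ * A) * (Sᵀ * A)) *ᵥ v) ⬝ᵥ ((pinv (Sᵀ * A) * (Sᵀ * A)) *ᵥ v)) := by
  obtain ⟨h1, h2, h3, h4⟩ := pinv_spec (Sᵀ * A)
  set X := pinv (Sᵀ * A)
  set P := X * (Sᵀ * A)
  set z := colProj S *ᵥ (A *ᵥ v) with hz
  set w := Aᵀ *ᵥ z with hw
  have hw' : w = (Sᵀ * A)ᵀ *ᵥ ((Sᵀ * S)⁻¹ *ᵥ (Sᵀ *ᵥ (A *ᵥ v))) := by
    rw [hw, hz, colProj]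
    simp only [Matrix.mulVec_mulVec, Matrix.mul_assoc, Matrix.transpose_mul,
      Matrix.transpose_transpose]
  have hPw : P *ᵥ w = w := by
    have : P * (Sᵀ * A)ᵀ = (Sᵀ * A)ᵀ := by
      rw [← h4, ← Matrix.transpose_mul]
      rw [← Matrix.mul_assoc, h1]
    rw [hw', Matrix.mulVec_mulVec, this]
  have h5 : (P *ᵥ v) ⬝ᵥ w = z ⬝ᵥ z := by
    rw [Matrix.mulVec_dotProduct, h4, hPw, hw, ← Matrix.mulVec_dotProduct, hz,
      colProj_mulVec_dotProduct]
  have h6 := dotProduct_sq_le (P *ᵥ v) w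
  have h7 := transpose_mulVec_dotProduct_le (A := A) z
  rw [h5] at h6
  have h8 := dotProduct_self_nonneg' (P *ᵥ v)
  rcases (dotProduct_self_nonneg' z).eq_or_lt with h | h
  · rw [← h]; positivity
  · have : z ⬝ᵥ z * (z ⬝ᵥ z) ≤ z ⬝ᵥ z * (sigmaMax A ^ 2 * ((P *ᵥ v) ⬝ᵥ (P *ᵥ v))) := by
      nlinarith [mul_le_mul_of_nonneg_left h7 h8]
    exact le_of_mul_le_mul_left this h

end SketchStep

/-! ### Inverse Gram matrices and distances between rows. -/

section Gram

variable {p q : ℕ} (M : Matrix (Fin p) (Fin q) ℝ)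

theorem pinv_eq_of_isUnit (h : IsUnit (M * Mᵀ).det) : pinv M = Mᵀ * (M * Mᵀ)⁻¹ := by
  have h1 : M * (Mᵀ * (M * Mᵀ)⁻¹) = 1 := by rw [← Matrix.mul_assoc, Matrix.mul_nonsing_inv _ h]
  refine (pinv_spec M).unique ⟨?_, ?_, ?_, ?_⟩
  · rw [h1, Matrix.one_mul]
  · rw [Matrix.mul_assoc, h1, Matrix.mul_one]
  · rw [h1, Matrix.transpose_one]
  · simp only [Matrix.transpose_mul, Matrix.transpose_transpose, Matrix.transpose_nonsing_inv,
      Matrix.mul_assoc]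

/-- If every row of `M` is at distance at least `√τ` from the span of the other rows, then the
Gram matrix is invertible and the diagonal of its inverse is bounded by `τ⁻¹`. -/
theorem isUnit_gram_and_inv_diag_le {τ : ℝ} (hτ : 0 < τ)
    (h : ∀ (j : Fin p) (c : Fin p → ℝ), τ * c j ^ 2 ≤ (Mᵀ *ᵥ c) ⬝ᵥ (Mᵀ *ᵥ c)) :
    IsUnit (M * Mᵀ).det ∧ ∀ j, (M * Mᵀ)⁻¹ j j ≤ τ⁻¹ := by
  have hc : ∀ c : Fin p → ℝ, (Mᵀ *ᵥ c) ⬝ᵥ (Mᵀ *ᵥ c) = c ⬝ᵥ ((M * Mᵀ) *ᵥ c) := by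
    intro c
    rw [Matrix.mulVec_dotProduct, Matrix.transpose_transpose, Matrix.mulVec_mulVec]
  have hu : IsUnit (M * Mᵀ).det := by
    rw [isUnit_iff_ne_zero]
    intro h0
    obtain ⟨c, hne, hz⟩ := Matrix.exists_mulVec_eq_zero_iff.mpr h0
    apply hne
    funext j
    have := h j c
    rw [hc, hz, dotProduct_zero] at this
    have h2 : c j ^ 2 ≤ 0 := by nlinarith [sq_nonneg (c j)]
    simpa using le_antisymm h2 (sq_nonneg _)
  refine ⟨hu, fun j => ?_⟩
  -- On the `j`-th column of the inverse, the quadratic form equals the diagonal entry `a`, so the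
  -- hypothesis reads `τ a² ≤ a`.
  have := h j ((M * Mᵀ)⁻¹ *ᵥ Pi.single j 1)
  rw [hc, Matrix.mulVec_mulVec, Matrix.mul_nonsing_inv _ hu, Matrix.one_mulVec,
    Matrix.mulVec_single_one, dotProduct_single, mul_one] at this
  simp only [Matrix.col_apply] at this
  set a := (M * Mᵀ)⁻¹ j j
  rcases le_or_gt a 0 with ha | ha
  · exact ha.trans (by positivity)
  · rw [← one_div, le_div_iff₀ hτ]
    refine le_of_mul_le_mul_left (a := a) ?_ ha
    linarith

end Gram

/-! ### Standard Gaussians: invariance, resampling and exponential moments. -/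

section Gaussian

open scoped ENNReal

theorem MeasureTheory.lintegral_pi_prod {ι : Type*} [Fintype ι] {X : ι → Type*}
    [∀ i, MeasurableSpace (X i)] (μ : ∀ i, Measure (X i)) [∀ i, IsProbabilityMeasure (μ i)]
    {f : ∀ i, X i → ℝ≥0∞} (hf : ∀ i, Measurable (f i)) :
    ∫⁻ x, ∏ i, f i (x i) ∂Measure.pi μ = ∏ i, ∫⁻ x, f i x ∂μ i := by
  rw [lintegral_prod_eq_prod_lintegral_of_indepFun Finset.univ
    (fun i (x : ∀ i, X i) => f i (x i)) (iIndepFun_pi fun i => (hf i).aemeasurable) fun i => (hf i).comp (measurable_pi_apply i)]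
  refine Finset.prod_congr rfl fun i _ => ?_
  rw [← (measurePreserving_eval μ i).map_eq, lintegral_map (hf i) (measurable_pi_apply i)]

/-- Used at `a = -1` for a lower tail and at `a = 1/4` for an upper tail. -/
theorem lintegral_exp_mul_sq_gaussianReal {a : ℝ} (ha : a < 1 / 2) :
    ∫⁻ x, ENNReal.ofReal (Real.exp (a * x ^ 2)) ∂gaussianReal 0 1
      = ENNReal.ofReal (√(1 - 2 * a))⁻¹ := by
  have hb : 0 < 1 / 2 - a := by linarith
  have hfun : ∀ x : ℝ, gaussianPDFReal 0 1 x * Real.exp (a * x ^ 2)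
      = (√(2 * Real.pi))⁻¹ * Real.exp (-(1 / 2 - a) * x ^ 2) := by
    intro x
    simp only [gaussianPDFReal, NNReal.coe_one, mul_one, sub_zero]
    rw [mul_assoc, ← Real.exp_add]
    congr 2; ring
  rw [gaussianReal_of_var_ne_zero _ one_ne_zero,
    lintegral_withDensity_eq_lintegral_mul _ (measurable_gaussianPDF 0 1) (by fun_prop)]
  have : ∀ x : ℝ, (gaussianPDF 0 1 * fun x => ENNReal.ofReal (Real.exp (a * x ^ 2))) x
      = ENNReal.ofReal ((√(2 * Real.pi))⁻¹ * Real.exp (-(1 / 2 - a) * x ^ 2)) := by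
    intro x
    rw [Pi.mul_apply, gaussianPDF, ← ENNReal.ofReal_mul (gaussianPDFReal_nonneg 0 1 x), hfun]
  simp_rw [this]
  rw [← ofReal_integral_eq_lintegral_ofReal ((integrable_exp_neg_mul_sq hb).const_mul _)
    (Filter.Eventually.of_forall fun x => by positivity), integral_const_mul, integral_gaussian]
  congr 1
  rw [← Real.sqrt_inv, ← Real.sqrt_mul (by positivity), ← Real.sqrt_inv]
  congr 1
  have := Real.pi_pos.ne'
  have h2 : (1 - 2 * a) ≠ 0 := by linarith
  have h3 : (1 / 2 - a) ≠ 0 := by linarith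
  field_simp

variable {E F : Type*} [NormedAddCommGroup E] [InnerProductSpace ℝ E] [FiniteDimensional ℝ E]
  [MeasurableSpace E] [BorelSpace E] [NormedAddCommGroup F] [InnerProductSpace ℝ F]
  [FiniteDimensional ℝ F] [MeasurableSpace F] [BorelSpace F]

theorem charFun_stdGaussian_map (L : E →ₗ[ℝ] F) (t : F) :
    charFun ((stdGaussian E).map L) t
      = Complex.exp (-(‖LinearMap.adjoint L t‖ ^ 2 : ℝ) / 2) := by
  have hL : Measurable L := L.continuous_of_finiteDimensional.measurable
  have h := charFun_stdGaussian (E := E) (LinearMap.adjoint L t)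
  rw [charFun_apply] at h ⊢
  rw [integral_map hL.aemeasurable (by fun_prop)]
  simp_rw [LinearMap.adjoint_inner_right] at h
  rw [h]
  push_cast
  rfl

/-- A coisometry maps a standard Gaussian to a standard Gaussian. -/
theorem stdGaussian_map_of_norm_adjoint (L : E →ₗ[ℝ] F)
    (hL : ∀ t, ‖LinearMap.adjoint L t‖ = ‖t‖) : (stdGaussian E).map L = stdGaussian F := by
  refine Measure.ext_of_charFun ?_
  ext t
  rw [charFun_stdGaussian_map, charFun_stdGaussian, hL]
  push_cast
  rfl

/-- Resampling a standard Gaussian along the range of an isometric embedding. -/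
theorem lintegral_stdGaussian_resample (K : F →ₗ[ℝ] E)
    (hK : ∀ x, LinearMap.adjoint K (K x) = x) {f : E → ℝ≥0∞} (hf : Measurable f) :
    ∫⁻ Y, f Y ∂stdGaussian E
      = ∫⁻ Y, ∫⁻ g, f (Y - K (LinearMap.adjoint K Y) + K g) ∂stdGaussian F ∂stdGaussian E := by
  set L : E →ₗ[ℝ] E := LinearMap.id - K ∘ₗ LinearMap.adjoint K with hLdef
  have hLm : Measurable L := L.continuous_of_finiteDimensional.measurable
  have hKm : Measurable K := K.continuous_of_finiteDimensional.measurable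
  -- The components off and along the range of `K` are independent: the characteristic functions
  -- multiply by Pythagoras.
  have : stdGaussian E = (stdGaussian E).map L ∗ (stdGaussian F).map K := by
    have : IsProbabilityMeasure ((stdGaussian E).map L) :=
      Measure.isProbabilityMeasure_map hLm.aemeasurable
    have : IsProbabilityMeasure ((stdGaussian F).map K) :=
      Measure.isProbabilityMeasure_map hKm.aemeasurable
    refine Measure.ext_of_charFun ?_
    ext t
    rw [charFun_conv, charFun_stdGaussian_map, charFun_stdGaussian_map, charFun_stdGaussian,
      ← Complex.exp_add]
    congr 1
    have hadj : LinearMap.adjoint L t = t - K (LinearMap.adjoint K t) := by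
      rw [hLdef, map_sub, LinearMap.adjoint_comp, LinearMap.adjoint_adjoint]
      simp
    have hn : ‖LinearMap.adjoint L t‖ ^ 2 + ‖LinearMap.adjoint K t‖ ^ 2 = ‖t‖ ^ 2 := by
      have h1 : inner ℝ t (K (LinearMap.adjoint K t)) = ‖LinearMap.adjoint K t‖ ^ 2 := by
        rw [← LinearMap.adjoint_inner_left, real_inner_self_eq_norm_sq]
      have h2 : ‖K (LinearMap.adjoint K t)‖ ^ 2 = ‖LinearMap.adjoint K t‖ ^ 2 := by
        rw [← real_inner_self_eq_norm_sq, ← LinearMap.adjoint_inner_left, hK,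
          real_inner_self_eq_norm_sq]
      rw [hadj, norm_sub_sq_real, h1, h2]
      ring
    rw [← Complex.ofReal_pow, ← hn]
    push_cast
    ring
  conv_lhs => rw [this]
  rw [Measure.lintegral_conv hf, lintegral_map _ hLm]
  · refine lintegral_congr fun Y => ?_
    rw [lintegral_map (by fun_prop) hKm]
    rfl
  · exact Measurable.lintegral_prod_right' (f := fun p : E × E => f (p.1 + p.2)) (by fun_prop)

theorem lintegral_exp_neg_norm_sq_stdGaussian :
    ∫⁻ y, ENNReal.ofReal (Real.exp (-‖y‖ ^ 2)) ∂stdGaussian E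
      = ENNReal.ofReal (√3)⁻¹ ^ Module.finrank ℝ E := by
  set b := stdOrthonormalBasis ℝ E
  rw [stdGaussian_eq_map_pi_orthonormalBasis b, lintegral_map (by fun_prop) (by fun_prop)]
  have : ∀ x : Fin (Module.finrank ℝ E) → ℝ, ENNReal.ofReal (Real.exp (-‖∑ i, x i • b i‖ ^ 2))
      = ∏ i, ENNReal.ofReal (Real.exp ((-1) * x i ^ 2)) := by
    intro x
    have hn : ‖∑ i, x i • b i‖ ^ 2 = ∑ i, x i ^ 2 := by
      have h := b.repr.symm.norm_map (WithLp.toLp 2 x)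
      rw [← b.sum_repr_symm] at h
      rw [show ∑ i, x i • b i = ∑ i, (WithLp.toLp 2 x) i • b i from rfl, h,
        EuclideanSpace.real_norm_sq_eq]
    rw [hn, ← ENNReal.ofReal_prod_of_nonneg fun i _ => Real.exp_nonneg _, ← Real.exp_sum,
      ← Finset.mul_sum, neg_one_mul]
  simp_rw [this]
  rw [lintegral_pi_prod _
    (f := fun _ (y : ℝ) => ENNReal.ofReal (Real.exp ((-1) * y ^ 2))) (fun i => by fun_prop)]
  simp_rw [lintegral_exp_mul_sq_gaussianReal (show (-1:ℝ) < 1 / 2 by norm_num)]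
  norm_num

/-- Lower tail of the squared norm of the projection of a Gaussian vector onto a subspace. -/
theorem stdGaussian_norm_orthogonalProjection_lt (W : Submodule ℝ E) {d : ℕ}
    (hd : d ≤ Module.finrank ℝ W) (t : ℝ) :
    stdGaussian E {y | ‖W.orthogonalProjectionOnto y‖ ^ 2 < t}
      ≤ ENNReal.ofReal (Real.exp t * (√3)⁻¹ ^ d) := by
  have hmap : (stdGaussian E).map (W.orthogonalProjectionOnto : E →ₗ[ℝ] W) = stdGaussian W := by
    refine stdGaussian_map_of_norm_adjoint _ fun t => ?_
    have : LinearMap.adjoint (W.orthogonalProjectionOnto : E →ₗ[ℝ] W) = W.subtype := by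
      rw [eq_comm, LinearMap.eq_adjoint_iff]
      intro x y
      simp
    rw [this]
    rfl
  have hm : Measurable (W.orthogonalProjectionOnto : E →ₗ[ℝ] W) :=
    W.orthogonalProjectionOnto.continuous.measurable
  have hset : MeasurableSet {y : W | ‖y‖ ^ 2 < t} :=
    measurableSet_lt (by fun_prop) measurable_const
  have h1 : stdGaussian E {y | ‖W.orthogonalProjectionOnto y‖ ^ 2 < t}
      = stdGaussian W {y : W | ‖y‖ ^ 2 < t} := by
    rw [← hmap, Measure.map_apply hm hset]
    rfl
  rw [h1]
  calc stdGaussian W {y : W | ‖y‖ ^ 2 < t}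
      = ∫⁻ y, {y : W | ‖y‖ ^ 2 < t}.indicator 1 y ∂stdGaussian W := by
        rw [lintegral_indicator_one hset]
    -- Exponential Markov: on the event, `1 ≤ exp (t - ‖y‖²)`.
    _ ≤ ∫⁻ y : W, ENNReal.ofReal (Real.exp t) * ENNReal.ofReal (Real.exp (-‖y‖ ^ 2))
          ∂stdGaussian W := by
        refine lintegral_mono fun y => ?_
        by_cases hy : y ∈ {y : W | ‖y‖ ^ 2 < t}
        · rw [Set.indicator_of_mem hy, ← ENNReal.ofReal_mul (Real.exp_nonneg _), ← Real.exp_add]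
          change (1 : ℝ≥0∞) ≤ _
          rw [ENNReal.one_le_ofReal]
          have : ‖y‖ ^ 2 < t := hy
          exact Real.one_le_exp (by linarith)
        · rw [Set.indicator_of_notMem hy]; positivity
    _ = ENNReal.ofReal (Real.exp t) * ENNReal.ofReal (√3)⁻¹ ^ Module.finrank ℝ W := by
        rw [lintegral_const_mul _ (by fun_prop), lintegral_exp_neg_norm_sq_stdGaussian]
    _ ≤ ENNReal.ofReal (Real.exp t) * ENNReal.ofReal (√3)⁻¹ ^ d := by
        gcongr 1
        refine pow_le_pow_of_le_one zero_le ?_ hd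
        rw [ENNReal.ofReal_le_one]
        exact inv_le_one_of_one_le₀ (Real.one_le_sqrt.mpr (by norm_num))
    _ = _ := by
        rw [ENNReal.ofReal_mul (Real.exp_nonneg _), ENNReal.ofReal_pow (by positivity)]

/-- A unit-variance linear functional of a standard Gaussian. -/
theorem lintegral_exp_inner_sq_stdGaussian {x : E} (hx : ‖x‖ = 1) :
    ∫⁻ g, ENNReal.ofReal (Real.exp (inner ℝ x g ^ 2 / 4)) ∂stdGaussian E
      = ENNReal.ofReal √2 := by
  have hmap : (stdGaussian E).map (innerₛₗ ℝ x) = gaussianReal 0 1 := by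
    refine Measure.ext_of_charFun ?_
    ext t
    have : LinearMap.adjoint (innerₛₗ ℝ x) t = t • x := by
      refine ext_inner_right ℝ fun y => ?_
      rw [LinearMap.adjoint_inner_left, real_inner_smul_left]
      simp [mul_comm]
    rw [charFun_stdGaussian_map, charFun_gaussianReal, this, norm_smul, hx]
    simp
    norm_cast
    ring_nf
  have hm : Measurable (innerₛₗ ℝ x) := (innerSL ℝ x).continuous.measurable
  have := lintegral_exp_mul_sq_gaussianReal (show (1/4:ℝ) < 1 / 2 by norm_num)
  rw [← hmap, lintegral_map (by fun_prop) hm] at this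
  convert this using 2
  · ext g; simp; ring_nf
  · rw [← Real.sqrt_inv]; norm_num

/-- Exponential moment of a Gaussian quadratic form with bounded trace. -/
theorem lintegral_exp_sum_inner_sq_stdGaussian_le {ι : Type*} [Fintype ι] (x : ι → E) {T : ℝ}
    (hT : ∑ i, ‖x i‖ ^ 2 ≤ T) :
    ∫⁻ g, ENNReal.ofReal (Real.exp ((∑ i, inner ℝ (x i) g ^ 2) / (4 * T))) ∂stdGaussian E
      ≤ ENNReal.ofReal √2 := by
  set T₀ := ∑ i, ‖x i‖ ^ 2 with hT₀
  have hnn : 0 ≤ T₀ := Finset.sum_nonneg fun i _ => sq_nonneg _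
  rcases hnn.eq_or_lt with h0 | hpos
  · have hx : ∀ i, x i = 0 := by
      intro i
      have := (Finset.sum_eq_zero_iff_of_nonneg fun i _ => sq_nonneg ‖x i‖).mp h0.symm i
        (Finset.mem_univ i)
      simpa using this
    simp only [hx, inner_zero_left]
    simp
  -- Jensen weights: the form becomes a convex combination of squares of standard normals, so no
  -- diagonalization is needed. A zero `x i` has weight zero, and its normalization does not matter.
  set w : ι → ℝ := fun i => ‖x i‖ ^ 2 / T₀ with hw
  have hw0 : ∀ i, 0 ≤ w i := fun i => by positivity
  have hw1 : ∑ i, w i = 1 := by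
    rw [hw, ← Finset.sum_div, div_self hpos.ne']
  set z : ι → E → ℝ := fun i g => inner ℝ (‖x i‖⁻¹ • x i) g ^ 2 / 4 with hz
  have hle : ∀ g, ENNReal.ofReal (Real.exp ((∑ i, inner ℝ (x i) g ^ 2) / (4 * T)))
      ≤ ∑ i, ENNReal.ofReal (w i) * ENNReal.ofReal (Real.exp (z i g)) := by
    intro g
    have h1 : (∑ i, inner ℝ (x i) g ^ 2) / (4 * T) ≤ (∑ i, inner ℝ (x i) g ^ 2) / (4 * T₀) := by
      have : 0 ≤ ∑ i, inner ℝ (x i) g ^ 2 := Finset.sum_nonneg fun i _ => sq_nonneg _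
      gcongr
    have h2 : (∑ i, inner ℝ (x i) g ^ 2) / (4 * T₀) = ∑ i, w i • z i g := by
      rw [Finset.sum_div]
      refine Finset.sum_congr rfl fun i _ => ?_
      simp only [hw, hz, smul_eq_mul, real_inner_smul_left]
      rcases eq_or_ne (x i) 0 with h | h
      · simp [h]
      · have := norm_ne_zero_iff.mpr h
        field_simp
    have h3 := convexOn_exp.map_sum_le (t := Finset.univ) (w := w) (p := fun i => z i g)
      (fun i _ => hw0 i) hw1 (fun i _ => Set.mem_univ _)
    have h4 : Real.exp ((∑ i, inner ℝ (x i) g ^ 2) / (4 * T)) ≤ ∑ i, w i * Real.exp (z i g) := by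
      refine (Real.exp_le_exp.mpr h1).trans ?_
      rw [h2]
      simpa using h3
    calc _ ≤ ENNReal.ofReal (∑ i, w i * Real.exp (z i g)) := ENNReal.ofReal_le_ofReal h4
      _ = _ := by
        rw [ENNReal.ofReal_sum_of_nonneg fun i _ => mul_nonneg (hw0 i) (Real.exp_nonneg _)]
        exact Finset.sum_congr rfl fun i _ => ENNReal.ofReal_mul (hw0 i)
  calc _ ≤ ∫⁻ g, ∑ i, ENNReal.ofReal (w i) * ENNReal.ofReal (Real.exp (z i g))
        ∂stdGaussian E := lintegral_mono hle
    _ = ∑ i, ENNReal.ofReal (w i) * ∫⁻ g, ENNReal.ofReal (Real.exp (z i g)) ∂stdGaussian E := by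
        rw [lintegral_finsetSum _ fun i _ => by fun_prop]
        exact Finset.sum_congr rfl fun i _ => lintegral_const_mul _ (by fun_prop)
    _ ≤ ∑ i, ENNReal.ofReal (w i) * ENNReal.ofReal √2 := by
        refine Finset.sum_le_sum fun i _ => ?_
        rcases eq_or_ne (x i) 0 with h | h
        · simp [hw, h]
        · gcongr
          refine (lintegral_exp_inner_sq_stdGaussian ?_).le
          rw [norm_smul, norm_inv, norm_norm, inv_mul_cancel₀ (norm_ne_zero_iff.mpr h)]
    _ = ENNReal.ofReal √2 := by
        rw [← Finset.sum_mul, ← ENNReal.ofReal_sum_of_nonneg fun i _ => hw0 i, hw1,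
          ENNReal.ofReal_one, one_mul]

end Gaussian

/-! ### Conditioning of the sketched matrix and the residual form. -/

section SketchSpace

open scoped ENNReal

/-- The Euclidean space of `m × s` matrices with the Frobenius norm. -/
abbrev SketchSpace (m s : ℕ) := EuclideanSpace ℝ (Fin m × Fin s)

/-- The matrix of an element of `SketchSpace m s`. -/
def sketchMat {m s : ℕ} (Y : SketchSpace m s) : Matrix (Fin m) (Fin s) ℝ :=
  Matrix.of fun i j => Y (i, j)

variable {m n s : ℕ}

theorem continuous_sketchMat : Continuous (sketchMat : SketchSpace m s → _) := by
  refine continuous_matrix fun i j => ?_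
  simp only [sketchMat, Matrix.of_apply]
  fun_prop

/-- Embedding of `ℝᵐ` as the `j`-th column. -/
def columnEmbedding (m : ℕ) {s : ℕ} (j : Fin s) :
    EuclideanSpace ℝ (Fin m) →ₗ[ℝ] SketchSpace m s where
  toFun y := WithLp.toLp 2 fun p => if p.2 = j then y p.1 else 0
  map_add' x y := by ext p; by_cases h : p.2 = j <;> simp [h]
  map_smul' a y := by ext p; simp

theorem columnEmbedding_apply (j : Fin s) (y : EuclideanSpace ℝ (Fin m)) (p : Fin m × Fin s) :
    columnEmbedding m j y p = if p.2 = j then y p.1 else 0 := rfl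

theorem adjoint_columnEmbedding_apply (j : Fin s) (Y : SketchSpace m s) (i : Fin m) :
    LinearMap.adjoint (columnEmbedding m j) Y i = Y (i, j) := by
  have : LinearMap.adjoint (columnEmbedding m j) Y = WithLp.toLp 2 fun i => Y (i, j) := by
    refine ext_inner_right ℝ fun y => ?_
    rw [LinearMap.adjoint_inner_left]
    simp [PiLp.inner_apply, columnEmbedding, Fintype.sum_prod_type]
  rw [this]

theorem adjoint_columnEmbedding_columnEmbedding (j : Fin s) (x : EuclideanSpace ℝ (Fin m)) :
    LinearMap.adjoint (columnEmbedding m j) (columnEmbedding m j x) = x := by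
  ext i
  rw [adjoint_columnEmbedding_apply, columnEmbedding_apply, if_pos rfl]

/-- Embedding of `ℝˢ` into the matrices by `g ↦ u gᵀ`. -/
def outerEmbedding (s : ℕ) {m : ℕ} (u : EuclideanSpace ℝ (Fin m)) :
    EuclideanSpace ℝ (Fin s) →ₗ[ℝ] SketchSpace m s where
  toFun g := WithLp.toLp 2 fun p => u p.1 * g p.2
  map_add' x y := by ext p; simp [mul_add]
  map_smul' a y := by ext p; simp; ring

theorem outerEmbedding_apply (u : EuclideanSpace ℝ (Fin m)) (g : EuclideanSpace ℝ (Fin s))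
    (p : Fin m × Fin s) : outerEmbedding s u g p = u p.1 * g p.2 := rfl

theorem adjoint_outerEmbedding_apply (u : EuclideanSpace ℝ (Fin m)) (Y : SketchSpace m s)
    (k : Fin s) : LinearMap.adjoint (outerEmbedding s u) Y k = ∑ i, u i * Y (i, k) := by
  have : LinearMap.adjoint (outerEmbedding s u) Y
      = WithLp.toLp 2 fun k => ∑ i, u i * Y (i, k) := by
    refine ext_inner_right ℝ fun y => ?_
    rw [LinearMap.adjoint_inner_left]
    simp only [PiLp.inner_apply, outerEmbedding, Fintype.sum_prod_type, LinearMap.coe_mk,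
      AddHom.coe_mk, RCLike.inner_apply, conj_trivial]
    rw [Finset.sum_comm]
    refine Finset.sum_congr rfl fun k _ => ?_
    rw [Finset.mul_sum]
    exact Finset.sum_congr rfl fun i _ => by ring
  rw [this]

theorem adjoint_outerEmbedding_outerEmbedding {u : EuclideanSpace ℝ (Fin m)} (hu : ‖u‖ = 1)
    (g : EuclideanSpace ℝ (Fin s)) :
    LinearMap.adjoint (outerEmbedding s u) (outerEmbedding s u g) = g := by
  ext k
  have h : ∑ i, u i ^ 2 = 1 := by rw [← EuclideanSpace.real_norm_sq_eq, hu, one_pow]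
  rw [adjoint_outerEmbedding_apply]
  simp_rw [outerEmbedding_apply, ← mul_assoc, ← sq]
  rw [← Finset.sum_mul, h, one_mul]

variable (A : Matrix (Fin m) (Fin n) ℝ)

/-- The sketched matrices whose row `j` is at distance less than `√τ` from the span of the other
rows. -/
def nearDependent (s : ℕ) (τ : ℝ) (j : Fin s) : Set (SketchSpace m s) :=
  {Y | ∃ c : Fin s → ℝ, c j = 1 ∧
    (Aᵀ *ᵥ (sketchMat Y *ᵥ c)) ⬝ᵥ (Aᵀ *ᵥ (sketchMat Y *ᵥ c)) < τ}

theorem isOpen_nearDependent (τ : ℝ) (j : Fin s) : IsOpen (nearDependent A s τ j) := by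
  have : nearDependent A s τ j = ⋃ c : {c : Fin s → ℝ // c j = 1}, {Y |
      (Aᵀ *ᵥ (sketchMat Y *ᵥ c.1)) ⬝ᵥ (Aᵀ *ᵥ (sketchMat Y *ᵥ c.1)) < τ} := by
    ext Y
    simp [nearDependent]
  rw [this]
  refine isOpen_iUnion fun c => isOpen_lt ?_ continuous_const
  have h1 : Continuous fun Y : SketchSpace m s => Aᵀ *ᵥ (sketchMat Y *ᵥ c.1) :=
    continuous_const.matrix_mulVec (continuous_sketchMat.matrix_mulVec continuous_const)
  exact h1.dotProduct h1

variable {A}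

theorem sketchMat_resample_column_mulVec (j : Fin s) (Y : SketchSpace m s)
    (g : EuclideanSpace ℝ (Fin m)) (c : Fin s → ℝ) :
    sketchMat (Y - columnEmbedding m j (LinearMap.adjoint (columnEmbedding m j) Y)
      + columnEmbedding m j g) *ᵥ c
      = c j • g.ofLp + ∑ k ∈ Finset.univ.erase j, c k • fun i => Y (i, k) := by
  funext i
  rw [Matrix.mulVec, dotProduct, ← Finset.add_sum_erase _ _ (Finset.mem_univ j), Pi.add_apply,
    Finset.sum_apply]
  congr 1
  · simp [sketchMat, columnEmbedding_apply, adjoint_columnEmbedding_apply, mul_comm]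
  · refine Finset.sum_congr rfl fun k hk => ?_
    have : k ≠ j := Finset.ne_of_mem_erase hk
    simp [sketchMat, columnEmbedding_apply, this, mul_comm]

/-- Fix all columns of the sketch but the `j`-th, `g`. Let `W` consist of the vectors of `range A`
orthogonal to the fixed columns. If row `j` of `SᵀA` is close to the span of the other rows, then
the projection of `g` onto `W` is short, which is unlikely because `W` is large. -/
theorem stdGaussian_nearDependent_le (hσ : 0 < sigmaMin A) {t : ℝ} (ht : 0 < t) (j : Fin s) :
    stdGaussian (SketchSpace m s) (nearDependent A s (sigmaMin A ^ 2 * t) j)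
      ≤ ENNReal.ofReal (Real.exp t * (√3)⁻¹ ^ (n + 1 - s)) := by
  set B := nearDependent A s (sigmaMin A ^ 2 * t) j with hB
  have hBm : MeasurableSet B := (isOpen_nearDependent A _ j).measurableSet
  rw [← lintegral_indicator_one hBm, lintegral_stdGaussian_resample _
    (adjoint_columnEmbedding_columnEmbedding j) (measurable_one.indicator hBm)]
  suffices h : ∀ Y, ∫⁻ g, B.indicator 1 (Y - columnEmbedding m j
      (LinearMap.adjoint (columnEmbedding m j) Y) + columnEmbedding m j g)
        ∂stdGaussian (EuclideanSpace ℝ (Fin m))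
      ≤ ENNReal.ofReal (Real.exp t * (√3)⁻¹ ^ (n + 1 - s)) by
    refine (lintegral_mono h).trans ?_
    simp
  intro Y
  -- the vectors of `range A` orthogonal to the other columns
  let φ : EuclideanSpace ℝ (Fin n) →ₗ[ℝ] ({k : Fin s // k ≠ j} → ℝ) :=
    { toFun := fun v k => (A *ᵥ v.ofLp) ⬝ᵥ fun i => Y (i, k.1)
      map_add' := fun x y => by funext k; simp [Matrix.mulVec_add, add_dotProduct]
      map_smul' := fun a y => by funext k; simp [Matrix.mulVec_smul, smul_dotProduct] }
  set W : Submodule ℝ (EuclideanSpace ℝ (Fin m)) :=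
    (LinearMap.ker φ).map (Matrix.toEuclideanLin A) with hW
  have hinj : Function.Injective (Matrix.toEuclideanLin A) := by
    rw [injective_iff_map_eq_zero]
    intro v hv
    have := sigmaMin_sq_mul_le (A := A) v
    rw [hv, norm_zero] at this
    have h2 : ‖v‖ ^ 2 ≤ 0 := by
      by_contra hc
      push Not at hc
      have : 0 < sigmaMin A ^ 2 * ‖v‖ ^ 2 := by positivity
      linarith
    have : ‖v‖ = 0 := by nlinarith [norm_nonneg v]
    exact norm_eq_zero.mp this
  -- Only `s - 1` constraints, from the columns other than `j`.
  have hdim : n + 1 - s ≤ Module.finrank ℝ W := by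
    have h1 := φ.finrank_range_add_finrank_ker
    have h2 : Module.finrank ℝ (LinearMap.range φ) ≤ s - 1 := by
      refine (Submodule.finrank_le _).trans ?_
      simp
    rw [hW, ← (Submodule.equivMapOfInjective _ hinj (LinearMap.ker φ)).finrank_eq]
    have h3 : Module.finrank ℝ (EuclideanSpace ℝ (Fin n)) = n := by simp
    have h4 : 0 < s := j.pos
    omega
  have hsub : ∀ g : EuclideanSpace ℝ (Fin m),
      Y - columnEmbedding m j (LinearMap.adjoint (columnEmbedding m j) Y)
        + columnEmbedding m j g ∈ B → ‖W.orthogonalProjectionOnto g‖ ^ 2 < t := by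
    rintro g ⟨c, hc, hlt⟩
    rw [sketchMat_resample_column_mulVec, hc, one_smul] at hlt
    obtain ⟨v, hv, hvw⟩ := (W.orthogonalProjectionOnto g).2
    set z := g.ofLp + ∑ k ∈ Finset.univ.erase j, c k • fun i => Y (i, k)
    have h1 : ‖W.orthogonalProjectionOnto g‖ ^ 2 = (A *ᵥ v.ofLp) ⬝ᵥ z := by
      have e1 : ‖W.orthogonalProjectionOnto g‖ ^ 2
          = inner ℝ (W.orthogonalProjectionOnto g : EuclideanSpace ℝ (Fin m)) g := by
        rw [← real_inner_self_eq_norm_sq, ← W.inner_orthogonalProjectionOnto_eq_of_mem_left]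
      have e2 : (A *ᵥ v.ofLp) ⬝ᵥ (∑ k ∈ Finset.univ.erase j, c k • fun i => Y (i, k)) = 0 := by
        rw [dotProduct_sum]
        refine Finset.sum_eq_zero fun k hk => ?_
        have : φ v ⟨k, Finset.ne_of_mem_erase hk⟩ = 0 := by
          rw [LinearMap.mem_ker.mp hv]; rfl
        rw [dotProduct_smul]
        change c k • φ v ⟨k, Finset.ne_of_mem_erase hk⟩ = 0
        rw [this, smul_zero]
      rw [dotProduct_add, e2, add_zero, e1, ← hvw, EuclideanSpace.inner_eq_star_dotProduct,
        star_trivial, dotProduct_comm]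
      rfl
    have h2 : ‖W.orthogonalProjectionOnto g‖ ^ 2 = ‖Matrix.toEuclideanLin A v‖ ^ 2 := by
      rw [hvw]; rfl
    have h3 := sigmaMin_sq_mul_le (A := A) v
    rw [← h2, EuclideanSpace.norm_sq_eq_dotProduct v] at h3
    rw [Matrix.mulVec_dotProduct] at h1
    have h4 := dotProduct_sq_le v.ofLp (Aᵀ *ᵥ z)
    rw [← h1] at h4
    set r := ‖W.orthogonalProjectionOnto g‖ ^ 2 with hr
    have hr0 : 0 ≤ r := by positivity
    by_contra hcon
    push Not at hcon
    have hrpos : 0 < r := ht.trans_le hcon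
    have hv0 := dotProduct_self_nonneg' v.ofLp
    have hσ2 : 0 < sigmaMin A ^ 2 := by positivity
    -- Cauchy–Schwarz for `r = ⟨v, Aᵀz⟩`, together with `σ_min² ‖v‖² ≤ ‖A v‖² = r`.
    have h5 : sigmaMin A ^ 2 * r ^ 2 ≤ r * ((Aᵀ *ᵥ z) ⬝ᵥ (Aᵀ *ᵥ z)) := by
      nlinarith [mul_le_mul_of_nonneg_right h3 (dotProduct_self_nonneg' (Aᵀ *ᵥ z))]
    nlinarith [mul_lt_mul_of_pos_left hlt hrpos, mul_le_mul_of_nonneg_left hcon hσ2.le]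
  refine le_trans ?_ (stdGaussian_norm_orthogonalProjection_lt W hdim t)
  have hm : MeasurableSet {y | ‖W.orthogonalProjectionOnto y‖ ^ 2 < t} :=
    measurableSet_lt (by fun_prop) measurable_const
  rw [← lintegral_indicator_one hm]
  refine lintegral_mono fun g => ?_
  by_cases hg : Y - columnEmbedding m j (LinearMap.adjoint (columnEmbedding m j) Y)
        + columnEmbedding m j g ∈ B
  · rw [Set.indicator_of_mem (show g ∈ {y | ‖W.orthogonalProjectionOnto y‖ ^ 2 < t} from
      hsub g hg)]
    rw [Set.indicator_of_mem hg]
    rfl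
  · rw [Set.indicator_of_notMem hg]; positivity

variable (A) in
/-- The sketches for which the Gram matrix of `SᵀA` is invertible with the diagonal of the inverse
bounded by `τ⁻¹`. -/
def wellConditioned (s : ℕ) (τ : ℝ) : Set (SketchSpace m s) :=
  {Y | IsUnit (((sketchMat Y)ᵀ * A) * ((sketchMat Y)ᵀ * A)ᵀ).det ∧
    ∀ j, (((sketchMat Y)ᵀ * A) * ((sketchMat Y)ᵀ * A)ᵀ)⁻¹ j j ≤ τ⁻¹}

theorem Matrix.measurable_nonsing_inv_apply {α p : Type*} [TopologicalSpace α] [MeasurableSpace α]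
    [BorelSpace α] [Fintype p] [DecidableEq p] {f : α → Matrix p p ℝ} (hf : Continuous f)
    (i j : p) : Measurable fun a => (f a)⁻¹ i j := by
  simp_rw [Matrix.inv_def, Ring.inverse_eq_inv', Matrix.smul_apply, smul_eq_mul]
  exact hf.matrix_det.measurable.inv.mul (hf.matrix_adjugate.matrix_elem i j).measurable

theorem continuous_sketchGram :
    Continuous fun Y : SketchSpace m s => ((sketchMat Y)ᵀ * A) * ((sketchMat Y)ᵀ * A)ᵀ := by
  have h : Continuous fun Y : SketchSpace m s => (sketchMat Y)ᵀ * A :=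
    continuous_sketchMat.matrix_transpose.matrix_mul continuous_const
  exact h.matrix_mul h.matrix_transpose

theorem measurableSet_wellConditioned (τ : ℝ) : MeasurableSet (wellConditioned A s τ) := by
  unfold wellConditioned
  refine MeasurableSet.inter (s₁ := {Y : SketchSpace m s | IsUnit _}) ?_ ?_
  · simp only [isUnit_iff_ne_zero]
    exact (measurableSet_eq_fun continuous_sketchGram.matrix_det.measurable
      measurable_const).compl
  · change MeasurableSet {Y : SketchSpace m s | ∀ j, _}
    rw [Set.ofPred_forall]
    exact MeasurableSet.iInter fun j => measurableSet_le
      (Matrix.measurable_nonsing_inv_apply continuous_sketchGram j j) measurable_const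

/-- Union bound over the rows; a combination with `c j ≠ 0` is rescaled to `c j = 1`. -/
theorem stdGaussian_compl_wellConditioned_le (hσ : 0 < sigmaMin A) {t : ℝ} (ht : 0 < t) :
    stdGaussian (SketchSpace m s) (wellConditioned A s (sigmaMin A ^ 2 * t))ᶜ
      ≤ ENNReal.ofReal (s * (Real.exp t * (√3)⁻¹ ^ (n + 1 - s))) := by
  set τ := sigmaMin A ^ 2 * t with hτ
  have hτ0 : 0 < τ := by positivity
  have hsub : (wellConditioned A s τ)ᶜ ⊆ ⋃ j, nearDependent A s τ j := by
    intro Y hY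
    by_contra hcon
    apply hY
    simp only [Set.mem_iUnion, nearDependent, Set.mem_ofPred_eq, not_exists, not_and, not_lt] at hcon
    refine isUnit_gram_and_inv_diag_le _ hτ0 fun j c => ?_
    rw [Matrix.transpose_mul, Matrix.transpose_transpose, ← Matrix.mulVec_mulVec]
    rcases eq_or_ne (c j) 0 with h | h
    · rw [h]
      simpa using dotProduct_self_nonneg' _
    · have := hcon j ((c j)⁻¹ • c) (by simp [h])
      simp only [Matrix.mulVec_smul, smul_dotProduct, dotProduct_smul, smul_eq_mul] at this
      have h2 : 0 < c j ^ 2 := by positivity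
      calc τ * c j ^ 2 ≤ _ := mul_le_mul_of_nonneg_right this h2.le
        _ = _ := by field_simp
  refine (measure_mono hsub).trans ((measure_iUnion_fintype_le _ _).trans ?_)
  refine (Finset.sum_le_sum fun j _ => stdGaussian_nearDependent_le hσ ht j).trans ?_
  rw [Finset.sum_const, Finset.card_univ, Fintype.card_fin, nsmul_eq_mul,
    ENNReal.ofReal_mul (Nat.cast_nonneg s), ENNReal.ofReal_natCast]

/-- A kernel vector of `S` is one of `AᵀS`. Hence `colProj` has trace `s` on well-conditioned
sketches. -/
theorem isUnit_transpose_mul_self_of_wellConditioned {τ : ℝ} {Y : SketchSpace m s}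
    (h : Y ∈ wellConditioned A s τ) : IsUnit ((sketchMat Y)ᵀ * sketchMat Y).det := by
  set S := sketchMat Y
  rw [isUnit_iff_ne_zero]
  intro h0
  obtain ⟨c, hne, hz⟩ := Matrix.exists_mulVec_eq_zero_iff.mpr h0
  have h1 : S *ᵥ c = 0 := by
    rw [← dotProduct_self_eq_zero, Matrix.mulVec_dotProduct, Matrix.mulVec_mulVec, hz,
      dotProduct_zero]
  refine h.1.ne_zero (Matrix.exists_mulVec_eq_zero_iff.mp ⟨c, hne, ?_⟩)
  rw [Matrix.transpose_mul, Matrix.transpose_transpose, ← Matrix.mulVec_mulVec,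
    ← Matrix.mulVec_mulVec (M := Aᵀ), h1, Matrix.mulVec_zero, Matrix.mulVec_zero]

variable (A) in
/-- The quadratic form `(Sᵀe)ᵀ (SᵀA AᵀS)⁻¹ Sᵀe`. -/
noncomputable def residualForm (e : Fin m → ℝ) (Y : SketchSpace m s) : ℝ :=
  ((sketchMat Y)ᵀ *ᵥ e) ⬝ᵥ
    ((((sketchMat Y)ᵀ * A) * ((sketchMat Y)ᵀ * A)ᵀ)⁻¹ *ᵥ ((sketchMat Y)ᵀ *ᵥ e))

theorem measurable_residualForm (e : Fin m → ℝ) :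
    Measurable (residualForm A e : SketchSpace m s → ℝ) := by
  have h : ∀ j, Measurable fun Y : SketchSpace m s => ((sketchMat Y)ᵀ *ᵥ e) j := fun j =>
    ((continuous_apply j).comp (continuous_sketchMat.matrix_transpose.matrix_mulVec
      continuous_const)).measurable
  unfold residualForm dotProduct
  refine Finset.measurable_sum _ fun j _ => (h j).mul ?_
  simp only [Matrix.mulVec, dotProduct]
  refine Finset.measurable_sum _ fun k _ =>
    (Matrix.measurable_nonsing_inv_apply continuous_sketchGram j k).mul (h k)

theorem pinv_mulVec_dotProduct_eq_residualForm (e : Fin m → ℝ) {τ : ℝ} {Y : SketchSpace m s}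
    (h : Y ∈ wellConditioned A s τ) :
    (pinv ((sketchMat Y)ᵀ * A) *ᵥ ((sketchMat Y)ᵀ *ᵥ e)) ⬝ᵥ
      (pinv ((sketchMat Y)ᵀ * A) *ᵥ ((sketchMat Y)ᵀ *ᵥ e)) = residualForm A e Y := by
  set M := (sketchMat Y)ᵀ * A
  have key : ∀ g, (pinv M *ᵥ g) ⬝ᵥ (pinv M *ᵥ g) = g ⬝ᵥ ((M * Mᵀ)⁻¹ *ᵥ g) := by
    intro g
    rw [pinv_eq_of_isUnit M h.1, ← Matrix.mulVec_mulVec, Matrix.mulVec_dotProduct,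
      Matrix.transpose_transpose, Matrix.mulVec_mulVec, Matrix.mulVec_mulVec,
      Matrix.mul_nonsing_inv _ h.1, Matrix.one_mulVec, dotProduct_comm]
  exact key _

theorem sketchMat_resample_outer_transpose_mulVec {u : EuclideanSpace ℝ (Fin m)} (hu : ‖u‖ = 1)
    (Y : SketchSpace m s) (g : EuclideanSpace ℝ (Fin s)) :
    (sketchMat (Y - outerEmbedding s u (LinearMap.adjoint (outerEmbedding s u) Y)
      + outerEmbedding s u g))ᵀ *ᵥ u.ofLp = g.ofLp := by
  have h : ∑ i, u i * u i = 1 := by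
    simp_rw [← sq]
    rw [← EuclideanSpace.real_norm_sq_eq, hu, one_pow]
  funext k
  simp only [Matrix.mulVec, dotProduct, Matrix.transpose_apply, sketchMat, Matrix.of_apply,
    PiLp.add_apply, PiLp.sub_apply, outerEmbedding_apply, adjoint_outerEmbedding_apply]
  simp_rw [add_mul, sub_mul, Finset.sum_add_distrib, Finset.sum_sub_distrib]
  have h1 : ∀ a : ℝ, ∑ i, u i * a * u i = a := by
    intro a
    calc ∑ i, u i * a * u i = (∑ i, u i * u i) * a := by
          rw [Finset.sum_mul]; exact Finset.sum_congr rfl fun i _ => by ring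
      _ = a := by rw [h, one_mul]
  rw [h1, h1]
  simp_rw [mul_comm (u _)]
  ring

/-- The resampled part of the sketch is a multiple of `u`, which is orthogonal to the columns of
`A`. This is the independence of `Sᵀe` and `SᵀA` in usable form. -/
theorem sketchMat_resample_outer_transpose_mul {u : EuclideanSpace ℝ (Fin m)}
    (hu : Aᵀ *ᵥ u.ofLp = 0) (Y : SketchSpace m s) (g : EuclideanSpace ℝ (Fin s)) :
    (sketchMat (Y - outerEmbedding s u (LinearMap.adjoint (outerEmbedding s u) Y)
      + outerEmbedding s u g))ᵀ * A = (sketchMat Y)ᵀ * A := by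
  have h : ∀ l, ∑ i, u i * A i l = 0 := by
    intro l
    have := congrFun hu l
    simpa [Matrix.mulVec, dotProduct, mul_comm] using this
  ext k l
  simp only [Matrix.mul_apply, Matrix.transpose_apply, sketchMat, Matrix.of_apply,
    PiLp.add_apply, PiLp.sub_apply, outerEmbedding_apply]
  simp_rw [add_mul, sub_mul, Finset.sum_add_distrib, Finset.sum_sub_distrib]
  have h1 : ∀ a : ℝ, ∑ i, u i * a * A i l = 0 := by
    intro a
    calc ∑ i, u i * a * A i l = (∑ i, u i * A i l) * a := by
          rw [Finset.sum_mul]; exact Finset.sum_congr rfl fun i _ => by ring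
      _ = 0 := by rw [h, zero_mul]
  rw [h1, h1]
  ring

/-- The residual of the least-squares problem is independent of `SᵀA`, so the residual form is,
conditionally on `SᵀA`, a Gaussian quadratic form of bounded trace. -/
theorem lintegral_exp_residualForm_le {e : Fin m → ℝ} (he : Aᵀ *ᵥ e = 0) {τ : ℝ} :
    ∫⁻ Y : SketchSpace m s, (wellConditioned A s τ).indicator
      (fun Y => ENNReal.ofReal (Real.exp (residualForm A e Y / (4 * ((e ⬝ᵥ e) * s * τ⁻¹))))) Y
        ∂stdGaussian (SketchSpace m s) ≤ ENNReal.ofReal √2 := by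
  set T := (e ⬝ᵥ e) * s * τ⁻¹ with hT
  set f : SketchSpace m s → ℝ≥0∞ := (wellConditioned A s τ).indicator
      (fun Y => ENNReal.ofReal (Real.exp (residualForm A e Y / (4 * T)))) with hf
  have hfm : Measurable f := by
    refine Measurable.indicator ?_ (measurableSet_wellConditioned τ)
    exact ((measurable_residualForm e).div_const _).exp.ennreal_ofReal
  -- A zero residual has no direction; then `T = 0`, and division by zero makes the exponent `0`.
  rcases (dotProduct_self_nonneg' e).eq_or_lt with h0 | hpos
  · have : ∀ Y, f Y ≤ ENNReal.ofReal √2 := by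
      intro Y
      refine (Set.indicator_le_self' (fun _ _ => zero_le) Y).trans ?_
      rw [hT, ← h0]
      simp
    refine (lintegral_mono this).trans ?_
    simp
  set r := √(e ⬝ᵥ e) with hr
  have hr0 : 0 < r := Real.sqrt_pos.mpr hpos
  have hrr : r * r = e ⬝ᵥ e := Real.mul_self_sqrt hpos.le
  set u : EuclideanSpace ℝ (Fin m) := WithLp.toLp 2 (r⁻¹ • e) with hu
  have hun : ‖u‖ = 1 := by
    have : ‖u‖ ^ 2 = 1 := by
      rw [EuclideanSpace.norm_sq_eq_dotProduct, hu]
      simp only [smul_dotProduct, dotProduct_smul, smul_eq_mul, ← hrr]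
      field_simp
    nlinarith [norm_nonneg u]
  have hue : e = r • u.ofLp := by
    rw [hu]; simp [smul_smul, hr0.ne']
  have hAu : Aᵀ *ᵥ u.ofLp = 0 := by
    rw [hu]; simp [Matrix.mulVec_smul, he]
  rw [lintegral_stdGaussian_resample _ (adjoint_outerEmbedding_outerEmbedding hun) hfm]
  suffices h : ∀ Y, ∫⁻ g, f (Y - outerEmbedding s u (LinearMap.adjoint (outerEmbedding s u) Y)
      + outerEmbedding s u g) ∂stdGaussian (EuclideanSpace ℝ (Fin s)) ≤ ENNReal.ofReal √2 by
    refine (lintegral_mono h).trans ?_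
    simp
  intro Y
  set M := (sketchMat Y)ᵀ * A with hM
  by_cases hY : Y ∈ wellConditioned A s τ
  -- As `XᵀX = (M Mᵀ)⁻¹`, the form is `r² ‖X g‖²`, a sum of squares over the rows of `r X`; their
  -- squared lengths add up to `r² tr (M Mᵀ)⁻¹ ≤ T`.
  · set X := Mᵀ * (M * Mᵀ)⁻¹ with hX
    have hXX : Xᵀ * X = (M * Mᵀ)⁻¹ := by
      rw [hX, Matrix.transpose_mul, Matrix.transpose_transpose, Matrix.transpose_nonsing_inv,
        Matrix.transpose_mul, Matrix.transpose_transpose, Matrix.mul_assoc,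
        ← Matrix.mul_assoc M, Matrix.mul_nonsing_inv _ hY.1, Matrix.mul_one]
    let x : Fin n → EuclideanSpace ℝ (Fin s) := fun i => WithLp.toLp 2 (r • X i)
    have hx : ∑ i, ‖x i‖ ^ 2 ≤ T := by
      have h1 : ∀ i, ‖x i‖ ^ 2 = r * r * ∑ k, X i k * X i k := by
        intro i
        rw [EuclideanSpace.norm_sq_eq_dotProduct]
        simp only [x, dotProduct, Pi.smul_apply, smul_eq_mul, Finset.mul_sum]
        exact Finset.sum_congr rfl fun k _ => by ring
      have h2 : ∑ i, ∑ k, X i k * X i k = ∑ k, (M * Mᵀ)⁻¹ k k := by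
        rw [Finset.sum_comm, ← hXX]
        rfl
      simp_rw [h1]
      rw [← Finset.mul_sum, h2, hrr, hT, mul_assoc]
      refine mul_le_mul_of_nonneg_left ?_ hpos.le
      calc ∑ k, (M * Mᵀ)⁻¹ k k ≤ ∑ _k : Fin s, τ⁻¹ := Finset.sum_le_sum fun k _ => hY.2 k
        _ = s * τ⁻¹ := by simp
    refine le_trans (lintegral_mono fun g => ?_)
      (lintegral_exp_sum_inner_sq_stdGaussian_le x hx)
    refine (Set.indicator_le_self' (fun _ _ => zero_le) _).trans (le_of_eq ?_)
    congr 3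
    unfold residualForm
    rw [sketchMat_resample_outer_transpose_mul hAu, hue, Matrix.mulVec_smul,
      sketchMat_resample_outer_transpose_mulVec hun, ← hM, ← hXX, ← Matrix.mulVec_mulVec,
      ← Matrix.mulVec_dotProduct, Matrix.mulVec_smul, dotProduct]
    refine Finset.sum_congr rfl fun i _ => ?_
    rw [EuclideanSpace.inner_eq_star_dotProduct, star_trivial]
    simp only [x, dotProduct_smul, Pi.smul_apply, smul_eq_mul]
    rw [dotProduct_comm, Matrix.mulVec]
    ring
  -- Being well conditioned depends on `SᵀA` only, so resampling does not change it.
  · have : ∀ g, f (Y - outerEmbedding s u (LinearMap.adjoint (outerEmbedding s u) Y)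
      + outerEmbedding s u g) = 0 := by
      intro g
      refine Set.indicator_of_notMem (fun hc => hY ?_) _
      unfold wellConditioned at hc ⊢
      rw [Set.mem_ofPred_eq, sketchMat_resample_outer_transpose_mul hAu] at hc
      exact hc
    simp_rw [this]
    simp

end SketchSpace

/-! ### Uniform lower bound for the average projection. -/

section ProjectionForm

open scoped ENNReal

variable {m n s N : ℕ}

/-- The quadratic form `u ↦ ‖Q u‖²` of the projection `Q` onto the column space. -/
noncomputable def projForm (u : Fin m → ℝ) (Y : SketchSpace m s) : ℝ :=
  u ⬝ᵥ (colProj (sketchMat Y) *ᵥ u)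

theorem projForm_eq (u : Fin m → ℝ) (Y : SketchSpace m s) : projForm u Y =
    (colProj (sketchMat Y) *ᵥ u) ⬝ᵥ (colProj (sketchMat Y) *ᵥ u) :=
  (colProj_mulVec_dotProduct _ _).symm

theorem projForm_nonneg (u : Fin m → ℝ) (Y : SketchSpace m s) : 0 ≤ projForm u Y := by
  rw [projForm_eq]; exact dotProduct_self_nonneg' _

theorem projForm_le (u : Fin m → ℝ) (Y : SketchSpace m s) : projForm u Y ≤ u ⬝ᵥ u := by
  rw [projForm_eq]; exact colProj_mulVec_dotProduct_le _ _

theorem projForm_smul (a : ℝ) (u : Fin m → ℝ) (Y : SketchSpace m s) :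
    projForm (a • u) Y = a ^ 2 * projForm u Y := by
  simp only [projForm, Matrix.mulVec_smul, smul_dotProduct, dotProduct_smul, smul_eq_mul]
  ring

/-- Parallelogram law for the seminorm `‖Q ·‖`, which is at most the norm. -/
theorem projForm_sub_le (u r : Fin m → ℝ) (Y : SketchSpace m s) :
    projForm (u - r) Y ≤ 2 * projForm u Y + 2 * (r ⬝ᵥ r) := by
  have h1 := projForm_nonneg (u + r) Y
  have h2 := projForm_le r Y
  have h3 : projForm (u - r) Y + projForm (u + r) Y = 2 * projForm u Y + 2 * projForm r Y := by
    simp only [projForm, Matrix.mulVec_sub, Matrix.mulVec_add, sub_dotProduct, add_dotProduct,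
      dotProduct_sub, dotProduct_add]
    ring
  linarith

theorem measurable_projForm (u : Fin m → ℝ) :
    Measurable (projForm u : SketchSpace m s → ℝ) := by
  have h : ∀ j, Measurable fun Y : SketchSpace m s => ((sketchMat Y)ᵀ *ᵥ u) j := fun j =>
    ((continuous_apply j).comp (continuous_sketchMat.matrix_transpose.matrix_mulVec
      continuous_const)).measurable
  have hG : Continuous fun Y : SketchSpace m s => (sketchMat Y)ᵀ * sketchMat Y :=
    continuous_sketchMat.matrix_transpose.matrix_mul continuous_sketchMat
  have : (projForm u : SketchSpace m s → ℝ) = fun Y => ((sketchMat Y)ᵀ *ᵥ u) ⬝ᵥ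
      (((sketchMat Y)ᵀ * sketchMat Y)⁻¹ *ᵥ ((sketchMat Y)ᵀ *ᵥ u)) := by
    funext Y
    rw [Matrix.mulVec_dotProduct, Matrix.transpose_transpose, projForm, colProj]
    simp only [Matrix.mulVec_mulVec, Matrix.mul_assoc]
  rw [this]
  simp only [dotProduct]
  refine Finset.measurable_sum _ fun j _ => (h j).mul ?_
  simp only [Matrix.mulVec, dotProduct] at h ⊢
  exact Finset.measurable_sum _ fun k _ =>
    (Matrix.measurable_nonsing_inv_apply hG j k).mul (h k)

/-- Left multiplication by a matrix. -/
def leftMul (s : ℕ) {m : ℕ} (O : Matrix (Fin m) (Fin m) ℝ) :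
    SketchSpace m s →ₗ[ℝ] SketchSpace m s where
  toFun Y := WithLp.toLp 2 fun p => ∑ i, O p.1 i * Y (i, p.2)
  map_add' x y := by ext p; simp [mul_add, Finset.sum_add_distrib]
  map_smul' a y := by
    ext p
    simp only [PiLp.smul_apply, smul_eq_mul, RingHom.id_apply, Finset.mul_sum]
    exact Finset.sum_congr rfl fun i _ => by ring

theorem sketchMat_leftMul (O : Matrix (Fin m) (Fin m) ℝ) (Y : SketchSpace m s) :
    sketchMat (leftMul s O Y) = O * sketchMat Y := rfl

theorem inner_eq_sum_sketchMat (X Y : SketchSpace m s) :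
    inner ℝ X Y = ((sketchMat X)ᵀ * sketchMat Y).trace := by
  rw [PiLp.inner_apply, Fintype.sum_prod_type, Finset.sum_comm, Matrix.trace]
  refine Finset.sum_congr rfl fun k _ => ?_
  rw [Matrix.diag_apply, Matrix.mul_apply]
  exact Finset.sum_congr rfl fun i _ => by simp [sketchMat, mul_comm]

theorem adjoint_leftMul (O : Matrix (Fin m) (Fin m) ℝ) :
    LinearMap.adjoint (leftMul s O) = leftMul s Oᵀ := by
  rw [eq_comm, LinearMap.eq_adjoint_iff]
  intro X Y
  rw [inner_eq_sum_sketchMat, inner_eq_sum_sketchMat, sketchMat_leftMul, sketchMat_leftMul,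
    Matrix.transpose_mul, Matrix.transpose_transpose, Matrix.mul_assoc]

theorem stdGaussian_map_leftMul {O : Matrix (Fin m) (Fin m) ℝ} (hO : O * Oᵀ = 1) :
    (stdGaussian (SketchSpace m s)).map (leftMul s O) = stdGaussian (SketchSpace m s) := by
  refine stdGaussian_map_of_norm_adjoint _ fun Y => ?_
  have : ‖leftMul s Oᵀ Y‖ ^ 2 = ‖Y‖ ^ 2 := by
    rw [← real_inner_self_eq_norm_sq, ← real_inner_self_eq_norm_sq, inner_eq_sum_sketchMat,
      inner_eq_sum_sketchMat, sketchMat_leftMul, Matrix.transpose_mul, Matrix.transpose_transpose,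
      Matrix.mul_assoc, ← Matrix.mul_assoc O, hO, Matrix.one_mul]
  rw [adjoint_leftMul]
  exact (sq_eq_sq₀ (norm_nonneg _) (norm_nonneg _)).mp this

theorem projForm_leftMul {O : Matrix (Fin m) (Fin m) ℝ} (hO : Oᵀ * O = 1) (u : Fin m → ℝ)
    (Y : SketchSpace m s) : projForm u (leftMul s O Y) = projForm (Oᵀ *ᵥ u) Y := by
  have h : (O * sketchMat Y)ᵀ * (O * sketchMat Y) = (sketchMat Y)ᵀ * sketchMat Y := by
    rw [Matrix.transpose_mul, Matrix.mul_assoc, ← Matrix.mul_assoc Oᵀ, hO, Matrix.one_mul]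
  rw [projForm, projForm, sketchMat_leftMul, colProj, colProj, h, Matrix.mulVec_dotProduct,
    Matrix.transpose_transpose, Matrix.transpose_mul]
  simp only [Matrix.mulVec_mulVec, Matrix.mul_assoc]

/-- A Householder reflection exchanging two unit vectors. -/
theorem exists_orthogonal_mulVec_eq {u v : Fin m → ℝ} (hu : u ⬝ᵥ u = 1) (hv : v ⬝ᵥ v = 1) :
    ∃ O : Matrix (Fin m) (Fin m) ℝ, Oᵀ = O ∧ O * O = 1 ∧ O *ᵥ u = v := by
  by_cases huv : u = v
  · exact ⟨1, by simp, by simp, by simp [huv]⟩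
  set w := u - v with hw
  have hw0 : w ⬝ᵥ w ≠ 0 := fun h => huv (sub_eq_zero.mp (dotProduct_self_eq_zero.mp h))
  have hwu : 2 * (w ⬝ᵥ u) = w ⬝ᵥ w := by
    simp only [hw, sub_dotProduct, dotProduct_sub, hu, hv, dotProduct_comm v u]
    ring
  refine ⟨1 - (2 / (w ⬝ᵥ w)) • Matrix.vecMulVec w w, ?_, ?_, ?_⟩
  · rw [Matrix.transpose_sub, Matrix.transpose_one, Matrix.transpose_smul,
      Matrix.transpose_vecMulVec]
  · have h2 : Matrix.vecMulVec w w * Matrix.vecMulVec w w = (w ⬝ᵥ w) • Matrix.vecMulVec w w := by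
      rw [Matrix.vecMulVec_mul_vecMulVec]
      ext i j
      simp [Matrix.vecMulVec_apply]
      ring
    have h3 : 2 / (w ⬝ᵥ w) * (2 / (w ⬝ᵥ w)) * (w ⬝ᵥ w) = 2 * (2 / (w ⬝ᵥ w)) := by
      field_simp
    rw [Matrix.sub_mul, Matrix.mul_sub, Matrix.mul_sub, Matrix.one_mul, Matrix.one_mul,
      Matrix.mul_one, Matrix.smul_mul, Matrix.mul_smul, h2, smul_smul, smul_smul,
      h3]
    module
  · rw [Matrix.sub_mulVec, Matrix.one_mulVec, Matrix.smul_mulVec, Matrix.vecMulVec_mulVec]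
    have : (2 / (w ⬝ᵥ w)) * (w ⬝ᵥ u) = 1 := by rw [div_mul_eq_mul_div, hwu, div_self hw0]
    funext i
    simp only [Pi.sub_apply, Pi.smul_apply, MulOpposite.smul_eq_mul_unop, MulOpposite.unop_op,
      smul_eq_mul]
    have hwi : w i = u i - v i := rfl
    linear_combination (-w i) * this - hwi

/-- A reflection taking `u` to `v` preserves the law of the sketch. -/
theorem lintegral_projForm_eq {u v : Fin m → ℝ} (hu : u ⬝ᵥ u = 1) (hv : v ⬝ᵥ v = 1) :
    ∫⁻ Y : SketchSpace m s, ENNReal.ofReal (projForm u Y) ∂stdGaussian (SketchSpace m s)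
      = ∫⁻ Y : SketchSpace m s, ENNReal.ofReal (projForm v Y)
        ∂stdGaussian (SketchSpace m s) := by
  obtain ⟨O, hOt, hOO, hOu⟩ := exists_orthogonal_mulVec_eq hu hv
  have hm : Measurable (leftMul s O) :=
    (leftMul s O).continuous_of_finiteDimensional.measurable
  conv_lhs => rw [← stdGaussian_map_leftMul (s := s) (by rw [hOt, hOO] : O * Oᵀ = 1)]
  rw [lintegral_map (measurable_projForm u).ennreal_ofReal hm]
  refine lintegral_congr fun Y => ?_
  rw [projForm_leftMul (by rw [hOt, hOO]), hOt, hOu]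

/-- The mean of the projection onto the column space of a Gaussian matrix. -/
theorem le_lintegral_projForm {G : Set (SketchSpace m s)} (hGm : MeasurableSet G)
    (hG : ∀ Y ∈ G, IsUnit ((sketchMat Y)ᵀ * sketchMat Y).det)
    (hP : ENNReal.ofReal (1 / 2) ≤ stdGaussian (SketchSpace m s) G) (hm : 0 < m) {u : Fin m → ℝ}
    (hu : u ⬝ᵥ u = 1) :
    ENNReal.ofReal (s / (2 * m)) ≤ ∫⁻ Y : SketchSpace m s, ENNReal.ofReal (projForm u Y)
        ∂stdGaussian (SketchSpace m s) := by
  set I := ∫⁻ Y : SketchSpace m s, ENNReal.ofReal (projForm u Y)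
    ∂stdGaussian (SketchSpace m s) with hI
  -- Over the standard basis the forms add up to the trace of the projection, which is `s` on `G`.
  have h1 : ∫⁻ Y : SketchSpace m s, ∑ i : Fin m, ENNReal.ofReal (projForm (Pi.single i 1) Y)
      ∂stdGaussian (SketchSpace m s) = m * I := by
    rw [lintegral_finsetSum _ fun i _ => (measurable_projForm _).ennreal_ofReal]
    rw [Finset.sum_congr rfl fun i _ => lintegral_projForm_eq (v := u) (by simp) hu]
    simp [hI]
  have h2 : ENNReal.ofReal (s * (1 / 2)) ≤ m * I := by
    rw [← h1]
    calc ENNReal.ofReal (s * (1 / 2))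
        = ENNReal.ofReal s * ENNReal.ofReal (1 / 2) := ENNReal.ofReal_mul (Nat.cast_nonneg s)
      _ ≤ ENNReal.ofReal s * stdGaussian (SketchSpace m s) G := by gcongr
      _ = ∫⁻ Y, G.indicator (fun _ => ENNReal.ofReal s) Y ∂stdGaussian (SketchSpace m s) := by
          rw [lintegral_indicator_const hGm]
      _ ≤ _ := by
          refine lintegral_mono fun Y => ?_
          by_cases hY : Y ∈ G
          · rw [Set.indicator_of_mem hY, ← colProj_trace _ (hG Y hY), Matrix.trace,
              ← ENNReal.ofReal_sum_of_nonneg fun i _ => projForm_nonneg _ _]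
            refine ENNReal.ofReal_le_ofReal (Finset.sum_le_sum fun i _ => ?_)
            rw [projForm, Matrix.mulVec_single_one, single_dotProduct, one_mul]
            rfl
          · rw [Set.indicator_of_notMem hY]; positivity
  have hm' : (0 : ℝ) < m := Nat.cast_pos.mpr hm
  have h3 : ENNReal.ofReal (s * (1 / 2)) = m * ENNReal.ofReal (s / (2 * m)) := by
    rw [← ENNReal.ofReal_natCast m, ← ENNReal.ofReal_mul hm'.le]
    congr 1
    field_simp
  rw [h3] at h2
  exact (ENNReal.mul_le_mul_iff_right (by exact_mod_cast hm.ne') (by simp)).mp h2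

/-- The chord of `exp` over `[-1, 0]`, with `exp (-1) ≤ 1/2`. -/
theorem Real.exp_neg_le_one_sub_half {x : ℝ} (h0 : 0 ≤ x) (h1 : x ≤ 1) :
    Real.exp (-x) ≤ 1 - x / 2 := by
  have h := convexOn_exp.2 (Set.mem_univ 0) (Set.mem_univ (-1)) (by linarith : 0 ≤ 1 - x) h0
    (by ring)
  simp only [smul_eq_mul, mul_zero, zero_add, mul_neg, mul_one, Real.exp_zero] at h
  have h2 : Real.exp (-1) ≤ 1 / 2 := by
    rw [Real.exp_neg, ← one_div]
    exact one_div_le_one_div_of_le (by norm_num) (by linarith [Real.add_one_le_exp 1])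
  nlinarith

theorem lintegral_exp_neg_le {Ω : Type*} [MeasurableSpace Ω] {P : Measure Ω}
    [IsProbabilityMeasure P] {X : Ω → ℝ} (hX : Measurable X) (h0 : ∀ ω, 0 ≤ X ω)
    (h1 : ∀ ω, X ω ≤ 1) {μ : ℝ} (hμ0 : 0 ≤ μ) (hμ : ENNReal.ofReal μ ≤ ∫⁻ ω, ENNReal.ofReal (X ω) ∂P) :
    ∫⁻ ω, ENNReal.ofReal (Real.exp (-X ω)) ∂P ≤ ENNReal.ofReal (Real.exp (-(μ / 2))) := by
  -- Written as a sum to avoid truncated subtraction; it integrates to `1 - μ/2 ≤ exp (-μ/2)`.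
  have hle : ∀ ω, ENNReal.ofReal (Real.exp (-X ω)) + ENNReal.ofReal (1 / 2) * ENNReal.ofReal (X ω)
      ≤ 1 := by
    intro ω
    rw [← ENNReal.ofReal_mul (by norm_num), ← ENNReal.ofReal_add (Real.exp_nonneg _)
      (by have := h0 ω; positivity), ENNReal.ofReal_le_one]
    linarith [Real.exp_neg_le_one_sub_half (h0 ω) (h1 ω)]
  have hsum := lintegral_mono (μ := P) hle
  rw [lintegral_add_left (by fun_prop),
    lintegral_const_mul _ hX.ennreal_ofReal] at hsum
  simp only [lintegral_const, measure_univ, mul_one] at hsum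
  have h2 : ENNReal.ofReal (μ / 2) ≤ ENNReal.ofReal (1 / 2) * ∫⁻ ω, ENNReal.ofReal (X ω) ∂P := by
    rw [show μ / 2 = 1 / 2 * μ by ring, ENNReal.ofReal_mul (by norm_num)]
    gcongr
  have h3 : ∫⁻ ω, ENNReal.ofReal (Real.exp (-X ω)) ∂P + ENNReal.ofReal (μ / 2)
      ≤ ENNReal.ofReal (Real.exp (-(μ / 2))) + ENNReal.ofReal (μ / 2) := by
    refine (add_le_add_right h2 _).trans (hsum.trans ?_)
    rw [← ENNReal.ofReal_add (Real.exp_nonneg _) (by positivity), ENNReal.one_le_ofReal]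
    linarith [Real.add_one_le_exp (-(μ / 2))]
  exact (ENNReal.add_le_add_iff_right ENNReal.ofReal_ne_top).mp h3

/-- Exponential Markov inequality for independent copies. -/
theorem measure_pi_one_le_prod_le {Ω : Type*} [MeasurableSpace Ω] {P : Measure Ω}
    [IsProbabilityMeasure P] {f : Ω → ℝ≥0∞} (hf : Measurable f) {a : ℝ}
    (h : ∫⁻ ω, f ω ∂P ≤ ENNReal.ofReal (Real.exp (-a))) :
    Measure.pi (fun _ : Fin N => P) {ω | 1 ≤ ∏ l, f (ω l)}
      ≤ ENNReal.ofReal (Real.exp (-(N * a))) := by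
  have h1 := mul_meas_ge_le_lintegral (μ := Measure.pi (fun _ : Fin N => P))
    (f := fun ω => ∏ l, f (ω l)) (by fun_prop) 1
  rw [one_mul, lintegral_pi_prod _ (f := fun _ => f) (fun _ => hf), Finset.prod_const,
    Finset.card_univ, Fintype.card_fin] at h1
  calc _ ≤ _ := h1
    _ ≤ ENNReal.ofReal (Real.exp (-a)) ^ N := by gcongr
    _ = _ := by
      rw [← ENNReal.ofReal_pow (Real.exp_nonneg _), ← Real.exp_nat_mul, mul_neg]

/-- Lower tail of a sum of independent copies of a variable with bounded exponential moment. -/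
theorem measure_pi_sum_lt_le {Ω : Type*} [MeasurableSpace Ω] {P : Measure Ω}
    [IsProbabilityMeasure P] {X : Ω → ℝ} (hX : Measurable X) {a b : ℝ}
    (h : ∫⁻ ω, ENNReal.ofReal (Real.exp (-X ω)) ∂P ≤ ENNReal.ofReal (Real.exp (-a))) :
    Measure.pi (fun _ : Fin N => P) {ω | ∑ l, X (ω l) < N * b}
      ≤ ENNReal.ofReal (Real.exp (-(N * (a - b)))) := by
  have hexp : ∀ ω, ENNReal.ofReal (Real.exp (b - X ω))
      = ENNReal.ofReal (Real.exp b) * ENNReal.ofReal (Real.exp (-X ω)) := by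
    intro ω
    rw [← ENNReal.ofReal_mul (Real.exp_nonneg _), ← Real.exp_add, sub_eq_add_neg]
  have hint : ∫⁻ ω, ENNReal.ofReal (Real.exp (b - X ω)) ∂P
      ≤ ENNReal.ofReal (Real.exp (-(a - b))) := by
    simp_rw [hexp]
    rw [lintegral_const_mul _ (by fun_prop), show -(a - b) = b + -a by ring, Real.exp_add,
      ENNReal.ofReal_mul (Real.exp_nonneg _)]
    gcongr
  refine (measure_mono fun ω hω => ?_).trans (measure_pi_one_le_prod_le (by fun_prop) hint)
  have hω' : ∑ l, X (ω l) < N * b := hω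
  rw [Set.mem_ofPred_eq]
  rw [← ENNReal.ofReal_prod_of_nonneg fun i _ => Real.exp_nonneg _, ← Real.exp_sum,
    ENNReal.one_le_ofReal]
  refine Real.one_le_exp ?_
  simp only [Finset.sum_sub_distrib, Finset.sum_const, Finset.card_univ, Fintype.card_fin,
    nsmul_eq_mul]
  linarith

/-- The points of `[-1, 1]ᵐ` with coordinates in `(8m)⁻¹ ℤ`. -/
noncomputable def gridPoint (k : Fin m → Fin (16 * m + 1)) : Fin m → ℝ :=
  fun i => ((k i : ℕ) - 8 * m : ℝ) / (8 * m)

/-- Round every coordinate down: `m` errors of at most `1/(8m)` each. -/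
theorem exists_gridPoint_near (hm : 0 < m) {u : Fin m → ℝ} (hu : u ⬝ᵥ u = 1) :
    ∃ k : Fin m → Fin (16 * m + 1), (u - gridPoint k) ⬝ᵥ (u - gridPoint k) ≤ 1 / (64 * m) := by
  have hm' : (0 : ℝ) < m := Nat.cast_pos.mpr hm
  have hui : ∀ i, |u i| ≤ 1 := by
    intro i
    have : u i * u i ≤ 1 := by
      rw [← hu]
      exact Finset.single_le_sum (f := fun i => u i * u i) (fun i _ => mul_self_nonneg _)
        (Finset.mem_univ i)
    rw [← sq_le_one_iff_abs_le_one]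
    nlinarith
  have hnn : ∀ i, 0 ≤ 8 * m * (u i + 1) := fun i => by
    have := (abs_le.mp (hui i)).1
    have : 0 ≤ u i + 1 := by linarith
    positivity
  have hlt : ∀ i, ⌊8 * m * (u i + 1)⌋₊ < 16 * m + 1 := by
    intro i
    rw [Nat.floor_lt (hnn i)]
    have := (abs_le.mp (hui i)).2
    push_cast
    nlinarith
  refine ⟨fun i => ⟨⌊8 * m * (u i + 1)⌋₊, hlt i⟩, ?_⟩
  have hr : ∀ i, (u i - gridPoint (fun i => ⟨⌊8 * m * (u i + 1)⌋₊, hlt i⟩) i) ^ 2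
      ≤ (1 / (8 * m)) ^ 2 := by
    intro i
    have h1 := Nat.floor_le (hnn i)
    have h2 := Nat.lt_floor_add_one (8 * m * (u i + 1))
    have e : u i - gridPoint (fun i => ⟨⌊8 * m * (u i + 1)⌋₊, hlt i⟩) i
        = (8 * m * (u i + 1) - ⌊8 * m * (u i + 1)⌋₊) / (8 * m) := by
      simp only [gridPoint]
      field_simp
      ring
    rw [e]
    gcongr
    linarith
  calc _ = ∑ i, (u i - gridPoint (fun i => ⟨⌊8 * m * (u i + 1)⌋₊, hlt i⟩) i) ^ 2 := by
        simp only [dotProduct, Pi.sub_apply, sq]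
    _ ≤ ∑ _i : Fin m, (1 / (8 * m) : ℝ) ^ 2 := Finset.sum_le_sum fun i _ => hr i
    _ = 1 / (64 * m) := by
        rw [Finset.sum_const, Finset.card_univ, Fintype.card_fin, nsmul_eq_mul]
        field_simp
        norm_num

variable (m s N) in
/-- Some grid vector has too small an average projection. -/
def gridFailure : Set (Fin N → SketchSpace m s) :=
  ⋃ k : Fin m → Fin (16 * m + 1),
    {ω | ∑ l, projForm (gridPoint k) (ω l) < N * (s / (8 * m) * (gridPoint k ⬝ᵥ gridPoint k))}

theorem measure_pi_gridFailure_le {G : Set (SketchSpace m s)} (hGm : MeasurableSet G)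
    (hG : ∀ Y ∈ G, IsUnit ((sketchMat Y)ᵀ * sketchMat Y).det)
    (hP : ENNReal.ofReal (1 / 2) ≤ stdGaussian (SketchSpace m s) G) (hm : 0 < m) :
    Measure.pi (fun _ : Fin N => stdGaussian (SketchSpace m s)) (gridFailure m s N)
      ≤ ENNReal.ofReal ((16 * m + 1) ^ m * Real.exp (-(N * (s / (8 * m))))) := by
  have hm' : (0 : ℝ) < m := Nat.cast_pos.mpr hm
  have hone : ∀ u : Fin m → ℝ, Measure.pi (fun _ : Fin N => stdGaussian (SketchSpace m s))
      {ω | ∑ l, projForm u (ω l) < N * (s / (8 * m) * (u ⬝ᵥ u))}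
      ≤ ENNReal.ofReal (Real.exp (-(N * (s / (8 * m))))) := by
    intro u
    rcases (dotProduct_self_nonneg' u).eq_or_lt with h0 | hpos
    · have : {ω : Fin N → SketchSpace m s |
          ∑ l, projForm u (ω l) < N * (s / (8 * m) * (u ⬝ᵥ u))} = ∅ := by
        ext ω
        simp only [Set.mem_ofPred_eq, Set.mem_empty_iff_false, iff_false, not_lt, ← h0, mul_zero]
        exact Finset.sum_nonneg fun l _ => projForm_nonneg _ _
      rw [this, measure_empty]
      positivity
    set r := √(u ⬝ᵥ u) with hr
    have hr0 : 0 < r := Real.sqrt_pos.mpr hpos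
    have hrr : r * r = u ⬝ᵥ u := Real.mul_self_sqrt hpos.le
    set v := r⁻¹ • u with hv
    have hvv : v ⬝ᵥ v = 1 := by
      simp only [hv, smul_dotProduct, dotProduct_smul, smul_eq_mul, ← hrr]
      field_simp
    have huv : u = r • v := by rw [hv, smul_smul, mul_inv_cancel₀ hr0.ne', one_smul]
    -- Mean `s/(2m)` gives the exponent `s/(4m)`; half of it is spent on the threshold, half remains
    -- as the rate.
    have key := measure_pi_sum_lt_le (N := N) (measurable_projForm v) (b := s / (8 * m))
      (lintegral_exp_neg_le (measurable_projForm v) (fun Y => projForm_nonneg v Y)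
        (fun Y => hvv ▸ projForm_le v Y) (by positivity)
        (le_lintegral_projForm hGm hG hP hm hvv))
    refine (measure_mono fun ω hω => ?_).trans (key.trans (le_of_eq ?_))
    · have h1 : ∑ l, projForm u (ω l) < N * (s / (8 * m) * (u ⬝ᵥ u)) := hω
      have h2 : ∑ l, projForm u (ω l) = r ^ 2 * ∑ l, projForm v (ω l) := by
        rw [Finset.mul_sum]
        exact Finset.sum_congr rfl fun l _ => by rw [huv, projForm_smul]
      rw [h2, ← hrr] at h1
      have hr2 : 0 < r ^ 2 := by positivity
      refine lt_of_mul_lt_mul_left (a := r ^ 2) ?_ hr2.le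
      calc _ < _ := h1
        _ = _ := by ring
    · congr 3
      field_simp
      ring
  refine (measure_iUnion_fintype_le _ _).trans ((Finset.sum_le_sum fun k _ =>
    hone (gridPoint k)).trans (le_of_eq ?_))
  rw [Finset.sum_const, Finset.card_univ, Fintype.card_pi_const, Fintype.card_fin, nsmul_eq_mul,
    ENNReal.ofReal_mul (by positivity), ENNReal.ofReal_pow (by positivity)]
  congr 1
  push_cast
  congr 1
  rw [← ENNReal.ofReal_natCast m, ENNReal.ofReal_add (by positivity) (by norm_num),
    ENNReal.ofReal_mul (by norm_num)]
  norm_num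

theorem le_sum_projForm_of_notMem_gridFailure (hm : 0 < m) (hs : 0 < s)
    {ω : Fin N → SketchSpace m s} (hω : ω ∉ gridFailure m s N) (u : Fin m → ℝ) :
    N * (s / (36 * m)) * (u ⬝ᵥ u) ≤ ∑ l, projForm u (ω l) := by
  have hm' : (1 : ℝ) ≤ m := Nat.one_le_cast.mpr hm
  have hs' : (1 : ℝ) ≤ s := Nat.one_le_cast.mpr hs
  have hunit : ∀ v : Fin m → ℝ, v ⬝ᵥ v = 1 → N * (s / (36 * m)) ≤ ∑ l, projForm v (ω l) := by
    intro v hv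
    obtain ⟨k, hk⟩ := exists_gridPoint_near hm hv
    set r := v - gridPoint k with hr
    have hg : gridPoint k = v - r := by rw [hr]; abel
    have h1 : N * (s / (8 * m) * (gridPoint k ⬝ᵥ gridPoint k))
        ≤ ∑ l, projForm (gridPoint k) (ω l) := by
      by_contra hcon
      push Not at hcon
      exact hω (Set.mem_iUnion.mpr ⟨k, hcon⟩)
    have h2 : ∑ l, projForm (gridPoint k) (ω l)
        ≤ 2 * ∑ l, projForm v (ω l) + N * (2 * (r ⬝ᵥ r)) := by
      calc _ ≤ ∑ l, (2 * projForm v (ω l) + 2 * (r ⬝ᵥ r)) :=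
            Finset.sum_le_sum fun l _ => by rw [hg]; exact projForm_sub_le _ _ _
        _ = _ := by
          rw [Finset.sum_add_distrib, ← Finset.mul_sum]
          simp
    have hrr : r ⬝ᵥ r ≤ 1 / 64 := by
      refine hk.trans ?_
      gcongr
      linarith
    have h3 : 3 / 4 ≤ gridPoint k ⬝ᵥ gridPoint k := by
      have hc := dotProduct_sq_le v r
      rw [hv, one_mul] at hc
      have : v ⬝ᵥ r ≤ 1 / 8 := by nlinarith
      rw [hg]
      simp only [sub_dotProduct, dotProduct_sub, dotProduct_comm r v, hv]
      nlinarith [dotProduct_self_nonneg' r]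
    have h4 : (N : ℝ) * (s / (8 * m) * (3 / 4))
        ≤ N * (s / (8 * m) * (gridPoint k ⬝ᵥ gridPoint k)) := by gcongr
    -- Why the mesh is of order `1/m`: as `1 ≤ s`, the rounding error is below the main term, and
    -- `3/32 - 1/32 = 2/32`.
    have h5 : (N : ℝ) * (2 * (r ⬝ᵥ r)) ≤ N * (2 * (s / (64 * m))) := by
      gcongr
      refine hk.trans ?_
      gcongr
    have h6 : (N : ℝ) * (s / (8 * m) * (3 / 4)) - N * (2 * (s / (64 * m)))
        = 2 * (N * (s / (32 * m))) := by
      field_simp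
      ring
    have h7 : (N : ℝ) * (s / (36 * m)) ≤ N * (s / (32 * m)) := by
      gcongr
      norm_num
    linarith
  rcases (dotProduct_self_nonneg' u).eq_or_lt with h0 | hpos
  · rw [← h0, mul_zero]
    exact Finset.sum_nonneg fun l _ => projForm_nonneg _ _
  set r := √(u ⬝ᵥ u) with hr
  have hr0 : 0 < r := Real.sqrt_pos.mpr hpos
  have hrr : r * r = u ⬝ᵥ u := Real.mul_self_sqrt hpos.le
  have hvv : (r⁻¹ • u) ⬝ᵥ (r⁻¹ • u) = 1 := by
    simp only [smul_dotProduct, dotProduct_smul, smul_eq_mul, ← hrr]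
    field_simp
  have := hunit _ hvv
  simp_rw [projForm_smul, ← Finset.mul_sum] at this
  calc N * (s / (36 * m)) * (u ⬝ᵥ u) ≤ r⁻¹ ^ 2 * (∑ l, projForm u (ω l)) * (u ⬝ᵥ u) := by gcongr
    _ = _ := by rw [← hrr]; field_simp

end ProjectionForm

/-! ### The recursion for the mean squared error under random sampling. -/

section Sampling

variable {m n s N : ℕ}

theorem finiteBGK_congr {A : Matrix (Fin m) (Fin n) ℝ} {b : EuclideanSpace ℝ (Fin m)}
    {S : Fin N → Matrix (Fin m) (Fin s) ℝ} {idx idx' : ℕ → Fin N} {x₀ : EuclideanSpace ℝ (Fin n)}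
    {k : ℕ} (h : ∀ i < k, idx i = idx' i) :
    finiteBGK A b S idx x₀ k = finiteBGK A b S idx' x₀ k := by
  induction k with
  | zero => rfl
  | succ k ih =>
    rw [finiteBGK, finiteBGK, ih fun i hi => h i (by omega), h k (by omega)]

variable {Ω : Type*} [MeasurableSpace Ω] {Q : Measure Ω} {τ : Ω → ℕ → Fin N}

theorem IsUniformSampling.integral_indicator_eq (hτ : IsUniformSampling Q τ) (k : ℕ) (l : Fin N) :
    ∫ ω, (if τ ω k = l then (1 : ℝ) else 0) ∂Q = (N : ℝ)⁻¹ := by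
  have h := (hτ.law k).integral_comp (f := fun i : Fin N => if i = l then (1 : ℝ) else 0)
    (measurable_of_countable _).aestronglyMeasurable
  have hprob : IsProbabilityMeasure (uniformOn (Set.univ : Set (Fin N))) :=
    isProbabilityMeasure_uniformOn Set.finite_univ ⟨l, Set.mem_univ l⟩
  rw [show (fun ω => if τ ω k = l then (1 : ℝ) else 0)
    = (fun i : Fin N => if i = l then (1 : ℝ) else 0) ∘ fun ω => τ ω k from rfl, h,
    integral_fintype (Integrable.of_finite)]
  simp [Measure.real, uniformOn_univ]

variable [IsProbabilityMeasure Q]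

/-- A function of the `k`-th iterate and a function of the `k`-th index are independent. -/
theorem IsUniformSampling.indepFun_finiteBGK (hτ : IsUniformSampling Q τ)
    (A : Matrix (Fin m) (Fin n) ℝ) (b : EuclideanSpace ℝ (Fin m))
    (S : Fin N → Matrix (Fin m) (Fin s) ℝ) (x₀ : EuclideanSpace ℝ (Fin n)) (k : ℕ)
    (f : EuclideanSpace ℝ (Fin n) → ℝ) :
    Integrable (fun ω => f (finiteBGK A b S (τ ω) x₀ k)) Q ∧
    ∀ g : Fin N → ℝ, IndepFun (fun ω => f (finiteBGK A b S (τ ω) x₀ k)) (fun ω => g (τ ω k)) Q := by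
  classical
  obtain ⟨ω₀⟩ := nonempty_of_isProbabilityMeasure Q
  set l₀ := τ ω₀ 0
  -- The `k`-th iterate as a function of the first `k` indices; the filler `l₀` is never read.
  let φ : (Finset.range k → Fin N) → ℝ := fun p =>
    f (finiteBGK A b S (fun i => if h : i ∈ Finset.range k then p ⟨i, h⟩ else l₀) x₀ k)
  have hφ : (fun ω => f (finiteBGK A b S (τ ω) x₀ k))
      = φ ∘ fun ω (i : Finset.range k) => τ ω i := by
    funext ω
    simp only [φ, Function.comp_apply]
    congr 1
    refine finiteBGK_congr fun i hi => ?_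
    rw [dif_pos (Finset.mem_range.mpr hi)]
  have hm : ∀ i, AEMeasurable (fun ω => τ ω i) Q := fun i => (hτ.law i).aemeasurable
  have hmT : AEMeasurable (fun ω (i : Finset.range k) => τ ω i) Q :=
    aemeasurable_pi_lambda _ fun i => hm i
  have hind := hτ.indep.indepFun_finset₀ (Finset.range k) {k} (by simp) hm
  refine ⟨?_, fun g => ?_⟩
  · rw [hφ]
    obtain ⟨C, hC⟩ := (Set.finite_range fun p => ‖φ p‖).bddAbove
    exact Integrable.of_bound
      ((measurable_of_countable φ).comp_aemeasurable hmT).aestronglyMeasurable C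
      (Filter.Eventually.of_forall fun ω => hC ⟨fun i => τ ω i, rfl⟩)
  · rw [hφ]
    exact hind.comp (ψ := fun p : ({k} : Finset ℕ) → Fin N => g (p ⟨k, by simp⟩))
      (measurable_of_countable φ) (measurable_of_countable _)

/-- A one-step contraction in mean gives a bound for all iterates. -/
theorem IsUniformSampling.integral_finiteBGK_le (hτ : IsUniformSampling Q τ) (hN : 0 < N)
    {A : Matrix (Fin m) (Fin n) ℝ} {b : EuclideanSpace ℝ (Fin m)}
    {S : Fin N → Matrix (Fin m) (Fin s) ℝ} {xs : EuclideanSpace ℝ (Fin n)} {ρ H : ℝ}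
    (hρ : ρ ≤ 1) (hH : 0 ≤ H)
    (hstep : ∀ x, ∑ l, ‖sketchStep A b (S l) x - xs‖ ^ 2
      ≤ N * ((1 - ρ) * ‖x - xs‖ ^ 2 + ρ * H))
    (x₀ : EuclideanSpace ℝ (Fin n)) (k : ℕ) :
    Integrable (fun ω => ‖finiteBGK A b S (τ ω) x₀ k - xs‖ ^ 2) Q ∧
    ∫ ω, ‖finiteBGK A b S (τ ω) x₀ k - xs‖ ^ 2 ∂Q ≤ (1 - ρ) ^ k * ‖x₀ - xs‖ ^ 2 + H := by
  have hint := fun k => (hτ.indepFun_finiteBGK A b S x₀ k (fun x => ‖x - xs‖ ^ 2)).1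
  refine ⟨hint k, ?_⟩
  induction k with
  | zero => simpa [finiteBGK] using hH
  | succ k ih =>
    set X : Ω → EuclideanSpace ℝ (Fin n) := fun ω => finiteBGK A b S (τ ω) x₀ k with hX
    have hNpos : (0 : ℝ) < N := Nat.cast_pos.mpr hN
    -- Split by the index drawn, so that independence turns the expectation into the average over
    -- the collection.
    have h1 : ∀ ω, ‖finiteBGK A b S (τ ω) x₀ (k + 1) - xs‖ ^ 2
        = ∑ l, ‖sketchStep A b (S l) (X ω) - xs‖ ^ 2 * (if τ ω k = l then (1 : ℝ) else 0) := by
      intro ω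
      simp [finiteBGK, hX]
    have h2 : ∀ l, Integrable (fun ω => ‖sketchStep A b (S l) (X ω) - xs‖ ^ 2) Q := fun l =>
      (hτ.indepFun_finiteBGK A b S x₀ k (fun x => ‖sketchStep A b (S l) x - xs‖ ^ 2)).1
    have hind : ∀ l, Integrable (fun ω => if τ ω k = l then (1 : ℝ) else 0) Q := by
      intro l
      refine Integrable.of_bound (C := 1) ?_ (Filter.Eventually.of_forall fun ω => ?_)
      · exact ((measurable_of_countable fun i : Fin N => if i = l then (1 : ℝ) else 0).comp_aemeasurable
          (hτ.law k).aemeasurable).aestronglyMeasurable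
      · split_ifs <;> simp
    have h3 : ∀ l, IndepFun (fun ω => ‖sketchStep A b (S l) (X ω) - xs‖ ^ 2)
        (fun ω => if τ ω k = l then (1 : ℝ) else 0) Q := fun l =>
      (hτ.indepFun_finiteBGK A b S x₀ k (fun x => ‖sketchStep A b (S l) x - xs‖ ^ 2)).2
        (fun i => if i = l then (1 : ℝ) else 0)
    have h4 : ∫ ω, ‖finiteBGK A b S (τ ω) x₀ (k + 1) - xs‖ ^ 2 ∂Q
        = (N : ℝ)⁻¹ * ∫ ω, ∑ l, ‖sketchStep A b (S l) (X ω) - xs‖ ^ 2 ∂Q := by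
      have h7 : ∀ l, Integrable (fun ω => ‖sketchStep A b (S l) (X ω) - xs‖ ^ 2
          * (if τ ω k = l then (1 : ℝ) else 0)) Q := fun l =>
        (h3 l).integrable_mul (h2 l) (hind l)
      simp_rw [h1]
      rw [integral_finsetSum _ fun l _ => h7 l,
        integral_finsetSum _ fun l _ => h2 l, Finset.mul_sum]
      refine Finset.sum_congr rfl fun l _ => ?_
      rw [(h3 l).integral_fun_mul_eq_mul_integral (h2 l).aestronglyMeasurable
        (hind l).aestronglyMeasurable, hτ.integral_indicator_eq, mul_comm]
    have h5 : ∫ ω, ∑ l, ‖sketchStep A b (S l) (X ω) - xs‖ ^ 2 ∂Q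
        ≤ ∫ ω, N * ((1 - ρ) * ‖X ω - xs‖ ^ 2 + ρ * H) ∂Q := by
      refine integral_mono (integrable_finsetSum _ fun l _ => h2 l) ?_ fun ω => hstep (X ω)
      exact (((hint k).const_mul _).add (integrable_const _)).const_mul _
    have h6 : ∫ ω, N * ((1 - ρ) * ‖X ω - xs‖ ^ 2 + ρ * H) ∂Q
        = N * ((1 - ρ) * ∫ ω, ‖X ω - xs‖ ^ 2 ∂Q + ρ * H) := by
      rw [integral_const_mul, integral_add ((hint k).const_mul _) (integrable_const _),
        integral_const_mul, integral_const, probReal_univ, one_smul]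
    rw [h6] at h5
    rw [h4]
    calc _ ≤ (N : ℝ)⁻¹ * (N * ((1 - ρ) * ∫ ω, ‖X ω - xs‖ ^ 2 ∂Q + ρ * H)) := by gcongr
      _ = (1 - ρ) * ∫ ω, ‖X ω - xs‖ ^ 2 ∂Q + ρ * H := by field_simp
      _ ≤ (1 - ρ) * ((1 - ρ) ^ k * ‖x₀ - xs‖ ^ 2 + H) + ρ * H := by
          gcongr
      _ = _ := by ring

end Sampling

/-! ### Failure events for the whole collection. -/

section Collection

open scoped ENNReal

variable {m n s N : ℕ} {A : Matrix (Fin m) (Fin n) ℝ}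

variable (A s N) in
/-- All sketches are well conditioned, but the average residual form is large. -/
def residualFailure (e : Fin m → ℝ) (τ : ℝ) : Set (Fin N → SketchSpace m s) :=
  {ω | (∀ l, ω l ∈ wellConditioned A s τ) ∧
    N * (8 * ((e ⬝ᵥ e) * s * τ⁻¹)) < ∑ l, residualForm A e (ω l)}

theorem measure_pi_residualFailure_le {e : Fin m → ℝ} (he : Aᵀ *ᵥ e = 0) {τ : ℝ} (hτ : 0 < τ)
    (hs : 0 < s) :
    Measure.pi (fun _ : Fin N => stdGaussian (SketchSpace m s)) (residualFailure s N A e τ)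
      ≤ ENNReal.ofReal (Real.exp (-N)) := by
  have hs' : (0 : ℝ) < s := Nat.cast_pos.mpr hs
  rcases (dotProduct_self_nonneg' e).eq_or_lt with h0 | hpos
  · have : residualFailure s N A e τ = ∅ := by
      ext ω
      simp only [residualFailure, Set.mem_ofPred_eq, Set.mem_empty_iff_false, iff_false]
      rintro ⟨-, h⟩
      have he0 : e = 0 := dotProduct_self_eq_zero.mp h0.symm
      simp [he0, residualForm] at h
    rw [this, measure_empty]
    positivity
  set T := (e ⬝ᵥ e) * s * τ⁻¹ with hT
  have hT0 : 0 < T := by positivity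
  -- The threshold `8T` in the exponent `residualForm / (4T)` is the `2` here; `exp (-2) √2 ≤ exp
  -- (-1)` then gives the rate `1` per sketch.
  set f : SketchSpace m s → ℝ≥0∞ := fun Y => ENNReal.ofReal (Real.exp (-2)) *
    (wellConditioned A s τ).indicator
      (fun Y => ENNReal.ofReal (Real.exp (residualForm A e Y / (4 * T)))) Y with hf
  have hfm0 : Measurable ((wellConditioned A s τ).indicator
      (fun Y => ENNReal.ofReal (Real.exp (residualForm A e Y / (4 * T))))) :=
    Measurable.indicator ((measurable_residualForm e).div_const _).exp.ennreal_ofReal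
      (measurableSet_wellConditioned τ)
  have hfm : Measurable f := hfm0.const_mul _
  have hfint : ∫⁻ Y, f Y ∂stdGaussian (SketchSpace m s) ≤ ENNReal.ofReal (Real.exp (-1)) := by
    rw [hf, lintegral_const_mul _ hfm0]
    calc _ ≤ ENNReal.ofReal (Real.exp (-2)) * ENNReal.ofReal √2 := by
          gcongr
          exact lintegral_exp_residualForm_le he
      _ ≤ _ := by
        rw [← ENNReal.ofReal_mul (Real.exp_nonneg _)]
        refine ENNReal.ofReal_le_ofReal ?_
        have h1 : √2 ≤ Real.exp 1 := by
          have := Real.add_one_le_exp 1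
          have h2 : √2 ≤ 2 := Real.sqrt_le_iff.mpr ⟨by norm_num, by norm_num⟩
          linarith
        calc Real.exp (-2) * √2 ≤ Real.exp (-2) * Real.exp 1 := by gcongr
          _ = Real.exp (-1) := by rw [← Real.exp_add]; norm_num
  have hle : residualFailure s N A e τ ⊆ {ω | 1 ≤ ∏ l, f (ω l)} := by
    rintro ω ⟨hω, hlt⟩
    have : ∀ l, f (ω l) = ENNReal.ofReal (Real.exp (residualForm A e (ω l) / (4 * T) - 2)) := by
      intro l
      simp only [hf]
      rw [Set.indicator_of_mem (hω l), ← ENNReal.ofReal_mul (Real.exp_nonneg _), ← Real.exp_add]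
      congr 2; ring
    rw [Set.mem_ofPred_eq, Finset.prod_congr rfl fun l _ => this l]
    rw [← ENNReal.ofReal_prod_of_nonneg fun i _ => Real.exp_nonneg _, ← Real.exp_sum,
      ENNReal.one_le_ofReal]
    refine Real.one_le_exp ?_
    rw [Finset.sum_sub_distrib, ← Finset.sum_div]
    simp only [Finset.sum_const, Finset.card_univ, Fintype.card_fin, nsmul_eq_mul]
    rw [sub_nonneg, le_div_iff₀ (by positivity)]
    linarith
  exact (measure_mono hle).trans (by simpa using measure_pi_one_le_prod_le (N := N) hfm hfint)

theorem measure_pi_not_wellConditioned_le {τ : ℝ} {ε : ℝ≥0∞}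
    (h : stdGaussian (SketchSpace m s) (wellConditioned A s τ)ᶜ ≤ ε) :
    Measure.pi (fun _ : Fin N => stdGaussian (SketchSpace m s))
      {ω | ¬ ∀ l, ω l ∈ wellConditioned A s τ} ≤ N * ε := by
  have : {ω : Fin N → SketchSpace m s | ¬ ∀ l, ω l ∈ wellConditioned A s τ}
      = ⋃ l, (fun ω => ω l) ⁻¹' (wellConditioned A s τ)ᶜ := by
    ext ω; simp
  rw [this]
  refine (measure_iUnion_fintype_le _ _).trans ?_
  refine (Finset.sum_le_sum (g := fun _ => ε) fun l _ => ?_).trans (by simp)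
  rw [(measurePreserving_eval (fun _ : Fin N => stdGaussian (SketchSpace m s)) l).measure_preimage
    (measurableSet_wellConditioned τ).compl.nullMeasurableSet]
  exact h

/-- The law of a Gaussian collection. -/
theorem IsGaussianCollection.map_eq {Ω : Type*} [MeasurableSpace Ω] {P : Measure Ω}
    [IsProbabilityMeasure P] {S : Ω → Fin N → Matrix (Fin m) (Fin s) ℝ}
    (hS : IsGaussianCollection P S) :
    AEMeasurable (fun ω l => (WithLp.toLp 2 fun p => S ω l p.1 p.2 : SketchSpace m s)) P ∧
    P.map (fun ω l => (WithLp.toLp 2 fun p => S ω l p.1 p.2 : SketchSpace m s))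
      = Measure.pi fun _ => stdGaussian (SketchSpace m s) := by
  have hm : ∀ t : Fin N × Fin m × Fin s, AEMeasurable (fun ω => S ω t.1 t.2.1 t.2.2) P :=
    fun t => (hS.law _ _ _).aemeasurable
  have hlaw := (iIndepFun_iff_map_fun_eq_pi_map hm).mp hS.indep
  simp_rw [fun t : Fin N × Fin m × Fin s => (hS.law t.1 t.2.1 t.2.2).map_eq] at hlaw
  have hmt : AEMeasurable (fun ω (t : Fin N × Fin m × Fin s) => S ω t.1 t.2.1 t.2.2) P :=
    aemeasurable_pi_lambda _ hm
  let Φ : (Fin N × Fin m × Fin s → ℝ) → Fin N → SketchSpace m s :=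
    fun y l => WithLp.toLp 2 fun p => y (l, p)
  have hΦ : Measurable Φ := by fun_prop
  refine ⟨hΦ.comp_aemeasurable hmt, ?_⟩
  -- Regroup the independent entries sketch by sketch.
  have hcurry : (Measure.pi fun _ : Fin N × Fin m × Fin s => gaussianReal 0 1).map
      (MeasurableEquiv.curry (Fin N) (Fin m × Fin s) ℝ)
      = Measure.pi fun _ : Fin N => Measure.pi fun _ : Fin m × Fin s => gaussianReal 0 1 := by
    have := Measure.infinitePi_map_curry
      (fun (_ : Fin N) (_ : Fin m × Fin s) => gaussianReal 0 1)
    simpa only [Measure.infinitePi_eq_pi] using this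
  have hpi := Measure.pi_map_pi (μ := fun _ : Fin N => Measure.pi fun _ : Fin m × Fin s =>
    gaussianReal 0 1) (f := fun _ => (WithLp.toLp 2 : _ → SketchSpace m s))
    (fun _ => by fun_prop)
  simp_rw [map_pi_eq_stdGaussian] at hpi
  change P.map (Φ ∘ fun ω (t : Fin N × Fin m × Fin s) => S ω t.1 t.2.1 t.2.2) = _
  rw [← AEMeasurable.map_map_of_aemeasurable hΦ.aemeasurable hmt, hlaw, ← hpi, ← hcurry,
    Measure.map_map (by fun_prop) (by fun_prop)]
  rfl

/-- One step of the method contracts the error in mean. -/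
theorem sum_norm_sq_sketchStep_sub_le {b : EuclideanSpace ℝ (Fin m)}
    {xs : EuclideanSpace ℝ (Fin n)} {τ : ℝ} (hσ : 0 < sigmaMin A) (hm : 0 < m) (hs : 0 < s)
    {ω : Fin N → SketchSpace m s} (hgrid : ω ∉ gridFailure m s N)
    (hwell : ∀ l, ω l ∈ wellConditioned A s τ)
    (hres : ω ∉ residualFailure s N A (A *ᵥ xs.ofLp - b.ofLp) τ)
    (x : EuclideanSpace ℝ (Fin n)) :
    ∑ l, ‖sketchStep A b (sketchMat (ω l)) x - xs‖ ^ 2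
      ≤ N * ((1 - s / (36 * m * kappaSq A)) * ‖x - xs‖ ^ 2
        + 8 * (‖Matrix.toEuclideanLin A xs - b‖ ^ 2 * s * τ⁻¹)) := by
  have hσM : 0 < sigmaMax A := hσ.trans_le sigmaMin_le_sigmaMax
  have hm' : (0 : ℝ) < m := Nat.cast_pos.mpr hm
  set e := A *ᵥ xs.ofLp - b.ofLp with he
  have he2 : ‖Matrix.toEuclideanLin A xs - b‖ ^ 2 = e ⬝ᵥ e :=
    EuclideanSpace.norm_sq_eq_dotProduct _
  set v := (x - xs).ofLp with hv
  have hv2 : ‖x - xs‖ ^ 2 = v ⬝ᵥ v := EuclideanSpace.norm_sq_eq_dotProduct _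
  have hres' : ∑ l, residualForm A e (ω l) ≤ N * (8 * ((e ⬝ᵥ e) * s * τ⁻¹)) := by
    by_contra hcon
    exact hres ⟨hwell, not_le.mp hcon⟩
  have hproj : N * (s / (36 * m * kappaSq A)) * (v ⬝ᵥ v) ≤
      ∑ l, (((pinv ((sketchMat (ω l))ᵀ * A) * ((sketchMat (ω l))ᵀ * A)) *ᵥ v) ⬝ᵥ
        ((pinv ((sketchMat (ω l))ᵀ * A) * ((sketchMat (ω l))ᵀ * A)) *ᵥ v)) := by
    have h1 := le_sum_projForm_of_notMem_gridFailure hm hs hgrid (A *ᵥ v)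
    have h2 : ∑ l, projForm (A *ᵥ v) (ω l) ≤ sigmaMax A ^ 2 *
        ∑ l, (((pinv ((sketchMat (ω l))ᵀ * A) * ((sketchMat (ω l))ᵀ * A)) *ᵥ v) ⬝ᵥ
          ((pinv ((sketchMat (ω l))ᵀ * A) * ((sketchMat (ω l))ᵀ * A)) *ᵥ v)) := by
      rw [Finset.mul_sum]
      refine Finset.sum_le_sum fun l _ => ?_
      rw [projForm_eq]
      exact colProj_mulVec_le _ _
    have h3 : N * (s / (36 * m)) * (sigmaMin A ^ 2 * (v ⬝ᵥ v))
        ≤ N * (s / (36 * m)) * ((A *ᵥ v) ⬝ᵥ (A *ᵥ v)) := by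
      gcongr
      exact sigmaMin_sq_mul_dotProduct_le v
    have h4 := h3.trans (h1.trans h2)
    refine le_of_mul_le_mul_left (a := sigmaMax A ^ 2) (le_trans (le_of_eq ?_) h4) (by positivity)
    rw [kappaSq]
    field_simp
  simp_rw [norm_sq_sketchStep_sub, ← hv, ← he,
    fun l => pinv_mulVec_dotProduct_eq_residualForm e (hwell l), hv2, he2]
  rw [Finset.sum_add_distrib, Finset.sum_sub_distrib, Finset.sum_const, Finset.card_univ,
    Fintype.card_fin, nsmul_eq_mul]
  linarith

end Collection

/-! ### Numerical bounds for the failure probabilities. -/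

section Numerics

variable {m n s N : ℕ} {c : ℝ}

theorem sq_sqrt_sub_sqrt_le (hsn : s < n) : (√(n : ℝ) - √(s : ℝ)) ^ 2 ≤ ((n + 1 - s : ℕ) : ℝ) := by
  have h1 : √(s : ℝ) ≤ √(n : ℝ) := Real.sqrt_le_sqrt (by exact_mod_cast hsn.le)
  have h2 := Real.sq_sqrt (Nat.cast_nonneg (α := ℝ) n)
  have h3 := Real.sq_sqrt (Nat.cast_nonneg (α := ℝ) s)
  have h4 := Real.sqrt_nonneg (s : ℝ)
  rw [Nat.cast_sub (by omega)]
  push_cast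
  nlinarith

/-- This is `exp 1 ≤ 3`. -/
theorem inv_sqrt_three_pow_le {D : ℝ} {d : ℕ} (hD : D ≤ d) :
    (√3)⁻¹ ^ d ≤ Real.exp (-(D / 2)) := by
  have h1 : (√3)⁻¹ ≤ Real.exp (-(1 / 2)) := by
    rw [Real.exp_neg]
    refine inv_anti₀ (Real.exp_pos _) (Real.le_sqrt_of_sq_le ?_)
    rw [← Real.exp_nat_mul]
    have : Real.exp ((2 : ℕ) * (1 / 2)) = Real.exp 1 := by norm_num
    rw [this]
    linarith [Real.exp_one_lt_d9]
  calc (√3)⁻¹ ^ d ≤ Real.exp (-(1 / 2)) ^ d := by gcongr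
    _ = Real.exp (-(d / 2)) := by rw [← Real.exp_nat_mul]; congr 1; ring
    _ ≤ _ := Real.exp_le_exp.mpr (by linarith)

theorem half_le_log_natCast (hm : 2 ≤ m) : 1 / 2 ≤ Real.log m := by
  have : Real.log 2 ≤ Real.log m := Real.log_le_log (by norm_num) (by exact_mod_cast hm)
  linarith [Real.log_two_gt_d9]

theorem natCast_le_of_log_bound (hm : 2 ≤ m) (hc : 3 < c)
    (hN : 64 * c * (m : ℝ) ^ 2 * Real.log m ≤ N) : 64 * (m : ℝ) ≤ N := by
  have hL := half_le_log_natCast hm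
  have hm' : (2 : ℝ) ≤ m := by exact_mod_cast hm
  refine le_trans ?_ hN
  calc 64 * (m : ℝ) ≤ 64 * 3 * (m : ℝ) ^ 2 * (1 / 2) := by nlinarith
    _ ≤ _ := by gcongr

/-- Exponents in units of `D`: `1/16` from `s ≤ N`, `1/4` from the threshold and `-1/2` from the
dimension. The resulting `-3/16` survives a further union bound over `N ≤ exp (D/16)` sketches. -/
theorem sketch_conditioning_prob_le {D : ℝ} (hsm : s ≤ m) (hmN : (m : ℝ) ≤ N)
    (hND : (N : ℝ) ≤ Real.exp (D / 16)) {d : ℕ} (hd : D ≤ d) :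
    s * (Real.exp (D / 4) * (√3)⁻¹ ^ d) ≤ Real.exp (-(3 * D / 16)) := by
  have hs : (s : ℝ) ≤ Real.exp (D / 16) := (Nat.cast_le.mpr hsm).trans (hmN.trans hND)
  calc s * (Real.exp (D / 4) * (√3)⁻¹ ^ d)
      ≤ Real.exp (D / 16) * (Real.exp (D / 4) * Real.exp (-(D / 2))) := by
        gcongr
        exact inv_sqrt_three_pow_le hd
    _ = _ := by rw [← Real.exp_add, ← Real.exp_add]; congr 1; ring

theorem exp_neg_natCast_le (hm : 2 ≤ m) (hc : 3 < c)
    (hN : 64 * c * (m : ℝ) ^ 2 * Real.log m ≤ N) :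
    Real.exp (-N) ≤ 0.1 * (m : ℝ) ^ (3 - c) := by
  have hL := half_le_log_natCast hm
  have hm' : (2 : ℝ) ≤ m := by exact_mod_cast hm
  have hm0 : (0 : ℝ) < m := by linarith
  rw [Real.rpow_def_of_pos hm0]
  set L := Real.log m
  have h1 : 64 * c * (2:ℝ) ^ 2 * L ≤ N := le_trans (by gcongr) hN
  have h2 : Real.exp (-9) ≤ 0.1 := by
    rw [Real.exp_neg]
    have := Real.add_one_le_exp 9
    calc (Real.exp 9)⁻¹ ≤ (9 + 1)⁻¹ := inv_anti₀ (by norm_num) this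
      _ = 0.1 := by norm_num
  calc Real.exp (-N) ≤ Real.exp (-9 + L * (3 - c)) := Real.exp_le_exp.mpr (by nlinarith)
    _ = Real.exp (-9) * Real.exp (L * (3 - c)) := Real.exp_add _ _
    _ ≤ _ := by gcongr

theorem grid_prob_le (hm : 2 ≤ m) (hs : 0 < s) (hc : 3 < c)
    (hN : 64 * c * (m : ℝ) ^ 2 * Real.log m ≤ N) :
    (16 * m + 1) ^ m * Real.exp (-(N * (s / (8 * m)))) ≤ (m : ℝ) ^ (3 - c) := by
  have hL := half_le_log_natCast hm
  have hm' : (2 : ℝ) ≤ m := by exact_mod_cast hm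
  have hs' : (1 : ℝ) ≤ s := by exact_mod_cast hs
  have hm0 : (0 : ℝ) < m := by linarith
  rw [Real.rpow_def_of_pos hm0]
  -- `16m + 1 ≤ m⁶` for `2 ≤ m`, so the grid costs `6 m log m` in the exponent, against a gain of `8
  -- c m log m`.
  have h1 : (16 * m + 1 : ℝ) ≤ Real.exp (6 * Real.log m) := by
    have e : Real.exp (6 * Real.log m) = (m : ℝ) ^ 6 := by
      rw [← Real.exp_log hm0, ← Real.exp_nat_mul, Real.exp_log hm0]; norm_num
    have : (2 : ℝ) ^ 5 ≤ (m : ℝ) ^ 5 := by gcongr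
    rw [e]
    nlinarith
  set L := Real.log m
  have h2 : 8 * c * m * L ≤ N * (s / (8 * m)) := by
    calc 8 * c * m * L = 64 * c * (m : ℝ) ^ 2 * L * (1 / (8 * m)) := by field_simp; norm_num
      _ ≤ N * (s / (8 * m)) := by gcongr
  calc _ ≤ Real.exp (6 * L) ^ m * Real.exp (-(8 * c * m * L)) := by gcongr
    _ = Real.exp ((6 * m - 8 * c * m) * L) := by
      rw [← Real.exp_nat_mul, ← Real.exp_add]; congr 1; ring
    _ ≤ Real.exp (L * (3 - c)) := by
      refine Real.exp_le_exp.mpr ?_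
      have : 6 * m - 8 * c * m ≤ 3 - c := by nlinarith
      nlinarith

end Numerics

/-! ### The case of empty sketches, the total failure probability and the conclusion. -/

theorem sketchStep_of_isEmpty {m n : ℕ} (A : Matrix (Fin m) (Fin n) ℝ)
    (b : EuclideanSpace ℝ (Fin m)) (S : Matrix (Fin m) (Fin 0) ℝ)
    (x : EuclideanSpace ℝ (Fin n)) : sketchStep A b S x = x := by
  have h1 : pinv (Sᵀ * A) * (Sᵀ * A) = 0 := by ext i j; simp [Matrix.mul_apply]
  have h2 : pinv (Sᵀ * A) * Sᵀ = 0 := by ext i j; simp [Matrix.mul_apply]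
  rw [sketchStep, h1, h2]
  ext i
  simp

theorem finiteBGK_of_isEmpty {m n N : ℕ} (A : Matrix (Fin m) (Fin n) ℝ)
    (b : EuclideanSpace ℝ (Fin m)) (S : Fin N → Matrix (Fin m) (Fin 0) ℝ) (idx : ℕ → Fin N)
    (x₀ : EuclideanSpace ℝ (Fin n)) (k : ℕ) : finiteBGK A b S idx x₀ k = x₀ := by
  induction k with
  | zero => rfl
  | succ k ih => rw [finiteBGK, sketchStep_of_isEmpty, ih]

theorem kappaSq_nonneg {m n : ℕ} (A : Matrix (Fin m) (Fin n) ℝ) : 0 ≤ kappaSq A := by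
  unfold kappaSq; positivity

open scoped ENNReal in
/-- The probability that a Gaussian collection fails to be well conditioned. -/
theorem measure_pi_failure_le {m n s N : ℕ} {A : Matrix (Fin m) (Fin n) ℝ} (hnm : n ≤ m)
    (hsn : s < n) (hs : 0 < s) (hσ : 0 < sigmaMin A) {e : Fin m → ℝ} (he : Aᵀ *ᵥ e = 0) {c D : ℝ}
    (hD0 : 0 < D) (hD : D ≤ ((n + 1 - s : ℕ) : ℝ)) (hc : 3 < c)
    (hN : 64 * c * (m : ℝ) ^ 2 * Real.log m ≤ N) (hND : (N : ℝ) ≤ Real.exp (D / 16)) :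
    Measure.pi (fun _ : Fin N => stdGaussian (SketchSpace m s))
      ({ω | ¬ ∀ l, ω l ∈ wellConditioned A s (sigmaMin A ^ 2 * (D / 4))} ∪
        (residualFailure s N A e (sigmaMin A ^ 2 * (D / 4)) ∪ gridFailure m s N))
      ≤ ENNReal.ofReal (1.1 * (m : ℝ) ^ (3 - c) + Real.exp (-(D / 16))) := by
  have hm : 2 ≤ m := by omega
  have hm0 : 0 < m := by omega
  have hm' : (2 : ℝ) ≤ m := by exact_mod_cast hm
  have hmN := natCast_le_of_log_bound hm hc hN
  set τ := sigmaMin A ^ 2 * (D / 4)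
  have hwell : stdGaussian (SketchSpace m s) (wellConditioned A s τ)ᶜ
      ≤ ENNReal.ofReal (Real.exp (-(3 * D / 16))) :=
    (stdGaussian_compl_wellConditioned_le hσ (by positivity)).trans (ENNReal.ofReal_le_ofReal
      (sketch_conditioning_prob_le (m := m) (by omega) (by linarith) hND hD))
  -- Well-conditioned sketches serve as the full-rank event `G` of the projection bound; the failure
  -- probability is at most `exp (-D/16) ≤ 1/N`.
  have hhalf : ENNReal.ofReal (1 / 2) ≤ stdGaussian (SketchSpace m s) (wellConditioned A s τ) := by
    have h1 : Real.exp (-(3 * D / 16)) ≤ 1 / 2 := by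
      have e1 : Real.exp (-(3 * D / 16)) ≤ Real.exp (-(D / 16)) :=
        Real.exp_le_exp.mpr (by linarith)
      refine e1.trans ?_
      rw [Real.exp_neg, ← one_div]
      exact one_div_le_one_div_of_le (by norm_num) (by linarith)
    have h2 := prob_add_prob_compl (μ := stdGaussian (SketchSpace m s))
      (measurableSet_wellConditioned (A := A) (s := s) τ)
    have h3 := hwell.trans (ENNReal.ofReal_le_ofReal h1)
    have h4 : (1 : ℝ≥0∞) = ENNReal.ofReal (1 / 2) + ENNReal.ofReal (1 / 2) := by
      rw [← ENNReal.ofReal_add (by norm_num) (by norm_num)]; norm_num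
    rw [h4] at h2
    have h5 : ENNReal.ofReal (1 / 2) + ENNReal.ofReal (1 / 2)
        ≤ stdGaussian (SketchSpace m s) (wellConditioned A s τ) + ENNReal.ofReal (1 / 2) := by
      rw [← h2]; gcongr
    exact (ENNReal.add_le_add_iff_right ENNReal.ofReal_ne_top).mp h5
  have hA : (N : ℝ≥0∞) * ENNReal.ofReal (Real.exp (-(3 * D / 16)))
      ≤ ENNReal.ofReal (Real.exp (-(D / 16))) := by
    rw [← ENNReal.ofReal_natCast, ← ENNReal.ofReal_mul (Nat.cast_nonneg N)]
    refine ENNReal.ofReal_le_ofReal ?_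
    calc N * Real.exp (-(3 * D / 16)) ≤ Real.exp (D / 16) * Real.exp (-(3 * D / 16)) := by gcongr
      _ = Real.exp (-(D / 8)) := by rw [← Real.exp_add]; congr 1; ring
      _ ≤ _ := Real.exp_le_exp.mpr (by linarith)
  have hrp : 0 ≤ (m : ℝ) ^ (3 - c) := by positivity
  calc _ ≤ ENNReal.ofReal (Real.exp (-(D / 16)))
        + (ENNReal.ofReal (0.1 * (m : ℝ) ^ (3 - c)) + ENNReal.ofReal ((m : ℝ) ^ (3 - c))) := by
        refine (measure_union_le _ _).trans (add_le_add ?_ ((measure_union_le _ _).trans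
          (add_le_add ?_ ?_)))
        · exact (measure_pi_not_wellConditioned_le hwell).trans hA
        · exact (measure_pi_residualFailure_le he (by positivity) hs).trans
            (ENNReal.ofReal_le_ofReal (exp_neg_natCast_le hm hc hN))
        · exact (measure_pi_gridFailure_le (measurableSet_wellConditioned τ)
            (fun Y hY => isUnit_transpose_mul_self_of_wellConditioned hY) hhalf hm0).trans
            (ENNReal.ofReal_le_ofReal (grid_prob_le hm hs hc hN))
    _ = _ := by
      rw [← ENNReal.ofReal_add (by positivity) hrp,
        ← ENNReal.ofReal_add (Real.exp_nonneg _) (by positivity)]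
      congr 1; ring

theorem theorem4 :
    ∃ C : ℝ, 0 < C ∧
      ∀ (m n s N : ℕ) (_ : n ≤ m) (_ : s < n)
        (A : Matrix (Fin m) (Fin n) ℝ) (_ : A.rank = n)
        (b : EuclideanSpace ℝ (Fin m)) (xs : EuclideanSpace ℝ (Fin n))
        (_ : IsLeastSquaresSol A b xs)
        (c : ℝ) (_ : 3 < c)
        (_ : 64 * c * (m : ℝ) ^ 2 * Real.log m ≤ N)
        (_ : (N : ℝ) ≤ Real.exp ((√(n : ℝ) - √(s : ℝ)) ^ 2 / 16))
        {Ω : Type*} [MeasurableSpace Ω] (P : Measure Ω) [IsProbabilityMeasure P]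
        (S : Ω → Fin N → Matrix (Fin m) (Fin s) ℝ) (_ : IsGaussianCollection P S)
        {Ω' : Type*} [MeasurableSpace Ω'] (Q : Measure Ω') [IsProbabilityMeasure Q]
        (τ : Ω' → ℕ → Fin N) (_ : IsUniformSampling Q τ),
        1 - 1.1 * (m : ℝ) ^ (3 - c) - Real.exp (-((√(n : ℝ) - √(s : ℝ)) ^ 2 / 16)) ≤
          P.real {ω | ∀ (x₀ : EuclideanSpace ℝ (Fin n)) (k : ℕ),
            Integrable (fun ω' => ‖finiteBGK A b (S ω) (τ ω') x₀ k - xs‖ ^ 2) Q ∧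
            ∫ ω', ‖finiteBGK A b (S ω) (τ ω') x₀ k - xs‖ ^ 2 ∂Q ≤
              (1 - s / (36 * m * kappaSq A)) ^ k * ‖x₀ - xs‖ ^ 2
                + C * m * kappaSq A / sigmaMin A ^ 2
                  * (‖Matrix.toEuclideanLin A xs - b‖ ^ 2 / (√(n : ℝ) - √(s : ℝ)) ^ 2)} := by
  -- The stationary error is gain over rate: `8 ‖e‖² s · 4/(σ_min² D)` divided by `s/(36 m κ²)`, and
  -- `32 · 36 = 1152`.
  refine ⟨1152, by norm_num, ?_⟩
  intro m n s N hnm hsn A hA b xs hxs c hc hN hND Ω _ P _ S hS Ω' _ Q _ τ hτ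
  have hκ := kappaSq_nonneg A
  set D := (√(n : ℝ) - √(s : ℝ)) ^ 2 with hDdef
  -- Empty sketches never move the iterate and the rate is `1`. For `0 < s` one gets `2 ≤ m`, which
  -- the numerical bounds need.
  rcases Nat.eq_zero_or_pos s with rfl | hs
  · have : {ω | ∀ (x₀ : EuclideanSpace ℝ (Fin n)) (k : ℕ),
            Integrable (fun ω' => ‖finiteBGK A b (S ω) (τ ω') x₀ k - xs‖ ^ 2) Q ∧
            ∫ ω', ‖finiteBGK A b (S ω) (τ ω') x₀ k - xs‖ ^ 2 ∂Q ≤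
              (1 - (0 : ℕ) / (36 * m * kappaSq A)) ^ k * ‖x₀ - xs‖ ^ 2
                + 1152 * m * kappaSq A / sigmaMin A ^ 2
                  * (‖Matrix.toEuclideanLin A xs - b‖ ^ 2 / D)} = Set.univ := by
      refine Set.eq_univ_of_forall fun ω x₀ k => ?_
      simp only [finiteBGK_of_isEmpty, integrable_const, integral_const, probReal_univ, one_smul,
        Nat.cast_zero, zero_div, sub_zero, one_pow, one_mul, true_and]
      have : 0 ≤ 1152 * m * kappaSq A / sigmaMin A ^ 2
        * (‖Matrix.toEuclideanLin A xs - b‖ ^ 2 / D) := by positivity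
      linarith
    rw [this, probReal_univ]
    have h1 : 0 ≤ (m : ℝ) ^ (3 - c) := by positivity
    have h2 := Real.exp_nonneg (-(D / 16))
    linarith
  have hσ := sigmaMin_pos (by omega) hA
  have hσM : 0 < sigmaMax A := hσ.trans_le sigmaMin_le_sigmaMax
  have hκ1 : 1 ≤ kappaSq A := by
    rw [kappaSq, one_le_div (by positivity)]
    gcongr
    exact sigmaMin_le_sigmaMax
  have hD0 : 0 < D := by
    have : √(s : ℝ) < √(n : ℝ) := Real.sqrt_lt_sqrt (Nat.cast_nonneg s) (by exact_mod_cast hsn)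
    have : 0 < √(n : ℝ) - √(s : ℝ) := by linarith
    positivity
  have hm : 2 ≤ m := by omega
  have hm' : (2 : ℝ) ≤ m := by exact_mod_cast hm
  have hs' : (1 : ℝ) ≤ s := by exact_mod_cast hs
  have hmN := natCast_le_of_log_bound hm hc hN
  have hNpos : 0 < N := by
    have : (0 : ℝ) < N := by linarith
    exact_mod_cast this
  set e := A *ᵥ xs.ofLp - b.ofLp with he
  set B := ({ω | ¬ ∀ l, ω l ∈ wellConditioned A s (sigmaMin A ^ 2 * (D / 4))} ∪
        (residualFailure s N A e (sigmaMin A ^ 2 * (D / 4)) ∪ gridFailure m s N)) with hB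
  have hfail := measure_pi_failure_le hnm hsn hs hσ (e := e) hxs.transpose_mulVec_eq_zero hD0
    (sq_sqrt_sub_sqrt_le hsn) hc hN hND
  rw [← hB] at hfail
  obtain ⟨hmeas, hmap⟩ := hS.map_eq
  set Y : Ω → Fin N → SketchSpace m s := fun ω l => WithLp.toLp 2 fun p => S ω l p.1 p.2 with hY
  have hpre : P (Y ⁻¹' B) ≤ ENNReal.ofReal (1.1 * (m : ℝ) ^ (3 - c) + Real.exp (-(D / 16))) := by
    refine (Measure.le_map_apply hmeas B).trans ?_
    rw [hmap]
    exact hfail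
  set good := {ω | ∀ (x₀ : EuclideanSpace ℝ (Fin n)) (k : ℕ),
            Integrable (fun ω' => ‖finiteBGK A b (S ω) (τ ω') x₀ k - xs‖ ^ 2) Q ∧
            ∫ ω', ‖finiteBGK A b (S ω) (τ ω') x₀ k - xs‖ ^ 2 ∂Q ≤
              (1 - s / (36 * m * kappaSq A)) ^ k * ‖x₀ - xs‖ ^ 2
                + 1152 * m * kappaSq A / sigmaMin A ^ 2
                  * (‖Matrix.toEuclideanLin A xs - b‖ ^ 2 / D)} with hgood
  -- A covering with subadditivity, so that measurability of `good` is not needed. `B` does not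
  -- involve `x₀` or `k`, hence the uniformity in both.
  have hsub : Set.univ ⊆ good ∪ Y ⁻¹' B := by
    intro ω _
    by_cases hω : Y ω ∈ B
    · exact Or.inr hω
    left
    intro x₀ k
    rw [hB, Set.mem_union, Set.mem_union, not_or, not_or] at hω
    obtain ⟨h1, h2, h3⟩ := hω
    rw [Set.mem_ofPred_eq, not_not] at h1
    have hstep := sum_norm_sq_sketchStep_sub_le hσ (by omega) hs h3 h1 h2
    have hSY : ∀ l, sketchMat (Y ω l) = S ω l := fun l => rfl
    simp_rw [hSY] at hstep
    refine hτ.integral_finiteBGK_le hNpos ?_ (by positivity) (fun x => (hstep x).trans ?_) x₀ k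
    · rw [div_le_one (by positivity)]
      have : (s : ℝ) ≤ m := by exact_mod_cast (hsn.le.trans hnm)
      nlinarith
    · refine le_of_eq ?_
      congr 2
      field_simp
      ring
  have hone : (1 : ℝ) ≤ P.real good + P.real (Y ⁻¹' B) := by
    rw [← probReal_univ (μ := P)]
    exact (measureReal_mono hsub).trans (measureReal_union_le _ _)
  have hreal : P.real (Y ⁻¹' B) ≤ 1.1 * (m : ℝ) ^ (3 - c) + Real.exp (-(D / 16)) :=
    ENNReal.toReal_le_of_le_ofReal (by positivity) hpre
  linarith
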